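/- Let $n\ge 2$ and $1\le k\le n-1$, and let $r,s\in\mathbb C$ be nonzero with $r\neq s$. Let $\epsilon_1,\dots,\epsilon_n$ be the orthonormal basis of $\mathbb Z^n$ and $\alpha_j=\epsilon_j-\epsilon_{j+1}$. Let $U=U_{r,s}(\mathfrak{sl}_n)$ be the unital associative $\mathbb C$-algebra with generators $e_i,f_i,\omega_i^{\pm1},\omega_i'^{\pm1}$ ($1\le i<n$) and relations: the $\omega_i^{\pm1},\omega_i'^{\pm1}$ are mutually inverse in pairs and commute with each other; $$\omega_ie_j=r^{\langle\epsilon_i,\alpha_j\rangle}s^{\langle\epsilon_{i+1},\alpha_j\rangle}e_j\omega_i,\quad \omega_if_j=r^{-\langle\epsilon_i,\alpha_j\rangle}s^{-\langle\epsilon_{i+1},\alpha_j\rangle}f_j\omega_i,$$ $$\omega_i'e_j=r^{\langle\epsilon_{i+1},\alpha_j\rangle}s^{\langle\epsilon_i,\alpha_j\rangle}e_j\omega_i',\quad \omega_i'f_j=r^{-\langle\epsilon_{i+1},\alpha_j\rangle}s^{-\langle\epsilon_i,\alpha_j\rangle}f_j\omega_i';$$ $[e_i,f_j]=\frac{\delta_{ij}}{r-s}(\omega_i-\omega_i')$;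 $[e_i,e_j]=[f_i,f_j]=0$ if $|i-j|>1$; and $$e_i^2e_{i+1}-(r+s)e_ie_{i+1}e_i+rs\,e_{i+1}e_i^2=0,\qquad e_ie_{i+1}^2-(r+s)e_{i+1}e_ie_{i+1}+rs\,e_{i+1}^2e_i=0,$$ $$f_i^2f_{i+1}-(r^{-1}+s^{-1})f_if_{i+1}f_i+r^{-1}s^{-1}f_{i+1}f_i^2=0,\qquad f_if_{i+1}^2-(r^{-1}+s^{-1})f_{i+1}f_if_{i+1}+r^{-1}s^{-1}f_{i+1}^2f_i=0.$$ The coproduct is given by $\Delta(e_i)=e_i\otimes1+\omega_i\otimes e_i$, $\Delta(f_i)=1\otimes f_i+f_i\otimes\omega_i'$, with $\omega_i,\omega_i'$ group-like. Let $V$ be the natural module, with basis $v_1,\dots,v_n$ and action $$e_j=E_{j,j+1},\quad f_j=E_{j+1,j},\quad \omega_j=rE_{jj}+sE_{j+1,j+1}+\sum_{l\ne j,j+1}E_{ll},\quad \omega_j'=sE_{jj}+rE_{j+1,j+1}+\sum_{l\neq j,j+1}E_{ll},$$ and let $V^{\otimes k}$ carry the $U$-action given by the iterated coproduct. Let $S^2_{r,s}(V)\subseteq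 V\otimes V$ be the span of all $v_i\otimes v_i$ and all $v_i\otimes v_j+s\,v_j\otimes v_i$ with $i<j$. Then $\sum_{i=0}^{k-2}V^{\otimes i}\otimes S^2_{r,s}(V)\otimes V^{\otimes(k-i-2)}$ is a $U$-submodule of $V^{\otimes k}$; let $$W_k=V^{\otimes k}\Big/\sum_{i=0}^{k-2}V^{\otimes i}\otimes S^2_{r,s}(V)\otimes V^{\otimes(k-i-2)}.$$ For $\mu\in\mathbb Z^n$ let $M(\mu)$ be the Verma module, that is, $U$ modulo the left ideal generated by all $e_i$, $\omega_i-r^{\langle\epsilon_i,\mu\rangle}s^{\langle\epsilon_{i+1},\mu\rangle}$ and $\omega_i'-r^{\langle\epsilon_{i+1},\mu\rangle}s^{\langle\epsilon_i,\mu\rangle}$. Put $\overline\omega_k=\epsilon_1+\dots+\epsilon_k$. **Theorem.** 1. The image of $v_1\otimes\cdots\otimes v_k$ in $W_k$ is a highest weight vector of weight $\overline\omega_k$: it is nonzero, every $e_i$ kills it, and $\omega_i$, $\omega_i'$ act on it by $r^{\langle\epsilon_i,\overline\omega_k\rangle}s^{\langle\epsilon_{i+1},\overline\omega_k\rangle}$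 and $r^{\langle\epsilon_{i+1},\overline\omega_k\rangle}s^{\langle\epsilon_i,\overline\omega_k\rangle}$. 2. $W_k$ is a simple $U$-module. 3. $W_k$ is isomorphic to a simple quotient of the Verma module $M(\overline\omega_k)$, by an isomorphism that sends the image of $v_1\otimes\cdots\otimes v_k$ to the image of the generator $1$. 4. If $r/s$ is not a root of unity, then $M(\overline\omega_k)$ has a largest proper submodule (the sum of all proper submodules is proper, and maximal), and $W_k$ is isomorphic, by an isomorphism as in 3, to the simple quotient $V(\overline\omega_k)$ of $M(\overline\omega_k)$ by it, the $k$-th fundamental representation. -/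

import Mathlib

set_option linter.unusedSimpArgs false

open scoped TensorProduct

noncomputable section

namespace RSWedge

/-- The parameters: two nonzero complex numbers `r ≠ s`. -/
structure Params where
  r : ℂ
  s : ℂ
  r_ne_zero : r ≠ 0
  s_ne_zero : s ≠ 0
  r_ne_s : r ≠ s

/-! ### The weight lattice `ℤε₁ ⊕ ⋯ ⊕ ℤεₙ` (indices are shifted to start at `0`) -/

/-- For the `j`-th simple root, the index `j` of `αⱼ = εⱼ - εⱼ₊₁`. -/
def lo {n : ℕ} (j : Fin (n - 1)) : Fin n := ⟨j.val, by omega⟩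

/-- For the `j`-th simple root, the index `j + 1` of `αⱼ = εⱼ - εⱼ₊₁`. -/
def hi {n : ℕ} (j : Fin (n - 1)) : Fin n := ⟨j.val + 1, by omega⟩

/-- The orthonormal vector `εₐ`. -/
def eps {n : ℕ} (a : Fin n) : Fin n → ℤ := Pi.single a 1

/-- The simple root `αⱼ = εⱼ - εⱼ₊₁`. -/
def simpleRoot {n : ℕ} (j : Fin (n - 1)) : Fin n → ℤ := eps (lo j) - eps (hi j)

/-- The fundamental weight `ε₁ + ⋯ + εₖ`. -/
def fundWeight (n k : ℕ) : Fin n → ℤ := ∑ a : Fin n with a.val < k, eps a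

/-- The scalar `r^⟨εᵢ, μ⟩ s^⟨εᵢ₊₁, μ⟩`, the value of the character of weight `μ` at `ωᵢ`. -/
def chi {n : ℕ} (r s : ℂ) (μ : Fin n → ℤ) (i : Fin (n - 1)) : ℂ :=
  r ^ (eps (lo i) ⬝ᵥ μ) * s ^ (eps (hi i) ⬝ᵥ μ)

/-- The scalar `r^⟨εᵢ₊₁, μ⟩ s^⟨εᵢ, μ⟩`, the value of the character of weight `μ` at `ω'ᵢ`. -/
def chi' {n : ℕ} (r s : ℂ) (μ : Fin n → ℤ) (i : Fin (n - 1)) : ℂ :=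
  r ^ (eps (hi i) ⬝ᵥ μ) * s ^ (eps (lo i) ⬝ᵥ μ)

/-! ### The two-parameter quantum group -/

/-- The generators `eᵢ`, `fᵢ`, `ωᵢ`, `ω'ᵢ`, `ωᵢ⁻¹`, `ω'ᵢ⁻¹`, `1 ≤ i < n`. -/
inductive Gen (n : ℕ) : Type
  | e (i : Fin (n - 1)) : Gen n
  | f (i : Fin (n - 1)) : Gen n
  | w (i : Fin (n - 1)) : Gen n
  | w' (i : Fin (n - 1)) : Gen n
  | wInv (i : Fin (n - 1)) : Gen n
  | wInv' (i : Fin (n - 1)) : Gen n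

/-- A generator as an element of the free algebra. -/
abbrev gen {n : ℕ} (g : Gen n) : FreeAlgebra ℂ (Gen n) := FreeAlgebra.ι ℂ g

open Gen in
/-- The defining relations of `U_{r,s}(sl_n)`. -/
inductive Rel (n : ℕ) (r s : ℂ) : FreeAlgebra ℂ (Gen n) → FreeAlgebra ℂ (Gen n) → Prop
  | w_mul_inv (i) : Rel n r s (gen (w i) * gen (wInv i)) 1
  | inv_mul_w (i) : Rel n r s (gen (wInv i) * gen (w i)) 1
  | w'_mul_inv (i) : Rel n r s (gen (w' i) * gen (wInv' i)) 1
  | inv_mul_w' (i) : Rel n r s (gen (wInv' i) * gen (w' i)) 1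
  | w_w (i j) : Rel n r s (gen (w i) * gen (w j)) (gen (w j) * gen (w i))
  | w_w' (i j) : Rel n r s (gen (w i) * gen (w' j)) (gen (w' j) * gen (w i))
  | w'_w' (i j) : Rel n r s (gen (w' i) * gen (w' j)) (gen (w' j) * gen (w' i))
  | w_e (i j) : Rel n r s (gen (w i) * gen (e j))
      (chi r s (simpleRoot j) i • (gen (e j) * gen (w i)))
  | w_f (i j) : Rel n r s (gen (w i) * gen (f j))
      (chi r s (-simpleRoot j) i • (gen (f j) * gen (w i)))
  | w'_e (i j) : Rel n r s (gen (w' i) * gen (e j))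
      (chi' r s (simpleRoot j) i • (gen (e j) * gen (w' i)))
  | w'_f (i j) : Rel n r s (gen (w' i) * gen (f j))
      (chi' r s (-simpleRoot j) i • (gen (f j) * gen (w' i)))
  | e_f_same (i) : Rel n r s (gen (e i) * gen (f i) - gen (f i) * gen (e i))
      ((r - s)⁻¹ • (gen (w i) - gen (w' i)))
  | e_f_ne (i j) (h : i ≠ j) : Rel n r s (gen (e i) * gen (f j)) (gen (f j) * gen (e i))
  | e_e (i j) (h : i.val + 1 < j.val) : Rel n r s (gen (e i) * gen (e j)) (gen (e j) * gen (e i))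
  | f_f (i j) (h : i.val + 1 < j.val) : Rel n r s (gen (f i) * gen (f j)) (gen (f j) * gen (f i))
  | serre_e₁ (i j) (h : j.val = i.val + 1) : Rel n r s
      (gen (e i) ^ 2 * gen (e j) - (r + s) • (gen (e i) * gen (e j) * gen (e i))
        + (r * s) • (gen (e j) * gen (e i) ^ 2)) 0
  | serre_e₂ (i j) (h : j.val = i.val + 1) : Rel n r s
      (gen (e i) * gen (e j) ^ 2 - (r + s) • (gen (e j) * gen (e i) * gen (e j))
        + (r * s) • (gen (e j) ^ 2 * gen (e i))) 0
  | serre_f₁ (i j) (h : j.val = i.val + 1) : Rel n r s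
      (gen (f i) ^ 2 * gen (f j) - (r⁻¹ + s⁻¹) • (gen (f i) * gen (f j) * gen (f i))
        + (r⁻¹ * s⁻¹) • (gen (f j) * gen (f i) ^ 2)) 0
  | serre_f₂ (i j) (h : j.val = i.val + 1) : Rel n r s
      (gen (f i) * gen (f j) ^ 2 - (r⁻¹ + s⁻¹) • (gen (f j) * gen (f i) * gen (f j))
        + (r⁻¹ * s⁻¹) • (gen (f j) ^ 2 * gen (f i))) 0

/-- The two-parameter quantum group `U_{r,s}(sl_n)`. -/
def U (n : ℕ) (r s : ℂ) : Type := RingQuot (Rel n r s)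

instance (n : ℕ) (r s : ℂ) : Ring (U n r s) := inferInstanceAs (Ring (RingQuot (Rel n r s)))

instance (n : ℕ) (r s : ℂ) : Algebra ℂ (U n r s) :=
  inferInstanceAs (Algebra ℂ (RingQuot (Rel n r s)))

/-- The projection from the free algebra to `U_{r,s}(sl_n)`. -/
def U.proj (n : ℕ) (r s : ℂ) : FreeAlgebra ℂ (Gen n) →ₐ[ℂ] U n r s :=
  RingQuot.mkAlgHom ℂ (Rel n r s)

/-- A generator as an element of `U_{r,s}(sl_n)`. -/
def U.of {n : ℕ} (r s : ℂ) (g : Gen n) : U n r s := U.proj n r s (gen g)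

lemma U.proj_rel {n : ℕ} {r s : ℂ} {x y : FreeAlgebra ℂ (Gen n)} (h : Rel n r s x y) :
    U.proj n r s x = U.proj n r s y := RingQuot.mkAlgHom_rel ℂ h

/-- The universal property of `U_{r,s}(sl_n)`. -/
def U.lift {n : ℕ} {r s : ℂ} {A : Type} [Ring A] [Algebra ℂ A] (g : Gen n → A)
    (h : ∀ ⦃x y⦄, Rel n r s x y → FreeAlgebra.lift ℂ g x = FreeAlgebra.lift ℂ g y) :
    U n r s →ₐ[ℂ] A :=
  RingQuot.liftAlgHom ℂ ⟨FreeAlgebra.lift ℂ g, h⟩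

lemma U.lift_of {n : ℕ} {r s : ℂ} {A : Type} [Ring A] [Algebra ℂ A] (g : Gen n → A)
    (h : ∀ ⦃x y⦄, Rel n r s x y → FreeAlgebra.lift ℂ g x = FreeAlgebra.lift ℂ g y) (x : Gen n) :
    U.lift g h (U.of r s x) = g x :=
  (RingQuot.liftAlgHom_mkAlgHom_apply ℂ (FreeAlgebra.lift ℂ g) h (gen x)).trans (by simp [gen])

/-- The generators generate: a multiplicative and additive property of elements of
`U_{r,s}(sl_n)` may be checked on generators. -/
lemma U.induction {n : ℕ} {r s : ℂ} {P : U n r s → Prop}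
    (hc : ∀ c : ℂ, P (algebraMap ℂ _ c)) (hg : ∀ g, P (U.of r s g))
    (hm : ∀ a b, P a → P b → P (a * b)) (ha : ∀ a b, P a → P b → P (a + b)) (x : U n r s) :
    P x := by
  obtain ⟨y, rfl⟩ := RingQuot.mkAlgHom_surjective ℂ (Rel n r s) x
  change P (U.proj n r s y)
  induction y using FreeAlgebra.induction with
  | grade0 c => rw [AlgHom.commutes]; exact hc c
  | grade1 g => exact hg g
  | mul a b iha ihb => rw [map_mul]; exact hm _ _ iha ihb
  | add a b iha ihb => rw [map_add]; exact ha _ _ iha ihb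

/-! ### The Hopf algebra structure: counit and coproduct -/

/-- The counit on generators. -/
def counitGen {n : ℕ} : Gen n → ℂ
  | .e _ => 0
  | .f _ => 0
  | .w _ => 1
  | .w' _ => 1
  | .wInv _ => 1
  | .wInv' _ => 1

/-- The counit of `U_{r,s}(sl_n)`. -/
def counit (n : ℕ) (r s : ℂ) : U n r s →ₐ[ℂ] ℂ :=
  U.lift counitGen (by
    intro x y h
    cases h <;> simp [gen, counitGen])

/-- The coproduct on generators: `Δ(e) = e ⊗ 1 + ω ⊗ e`, `Δ(f) = 1 ⊗ f + f ⊗ ω'`, and the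
`ω`, `ω'` are group-like. -/
def coprodGen {n : ℕ} (r s : ℂ) : Gen n → U n r s ⊗[ℂ] U n r s
  | .e i => U.of r s (.e i) ⊗ₜ 1 + U.of r s (.w i) ⊗ₜ U.of r s (.e i)
  | .f i => 1 ⊗ₜ U.of r s (.f i) + U.of r s (.f i) ⊗ₜ U.of r s (.w' i)
  | .w i => U.of r s (.w i) ⊗ₜ U.of r s (.w i)
  | .w' i => U.of r s (.w' i) ⊗ₜ U.of r s (.w' i)
  | .wInv i => U.of r s (.wInv i) ⊗ₜ U.of r s (.wInv i)
  | .wInv' i => U.of r s (.wInv' i) ⊗ₜ U.of r s (.wInv' i)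

section relations

variable {n : ℕ} {r s : ℂ}

lemma U.w_mul_inv (i : Fin (n - 1)) : U.of r s (.w i) * U.of r s (.wInv i) = 1 := by
  simpa [U.of] using U.proj_rel (Rel.w_mul_inv (r := r) (s := s) i)

lemma U.inv_mul_w (i : Fin (n - 1)) : U.of r s (.wInv i) * U.of r s (.w i) = 1 := by
  simpa [U.of] using U.proj_rel (Rel.inv_mul_w (r := r) (s := s) i)

lemma U.w'_mul_inv (i : Fin (n - 1)) : U.of r s (.w' i) * U.of r s (.wInv' i) = 1 := by
  simpa [U.of] using U.proj_rel (Rel.w'_mul_inv (r := r) (s := s) i)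

lemma U.inv_mul_w' (i : Fin (n - 1)) : U.of r s (.wInv' i) * U.of r s (.w' i) = 1 := by
  simpa [U.of] using U.proj_rel (Rel.inv_mul_w' (r := r) (s := s) i)

lemma U.w_w (i j : Fin (n - 1)) :
    U.of r s (.w i) * U.of r s (.w j) = U.of r s (.w j) * U.of r s (.w i) := by
  simpa [U.of] using U.proj_rel (Rel.w_w (r := r) (s := s) i j)

lemma U.w_w' (i j : Fin (n - 1)) :
    U.of r s (.w i) * U.of r s (.w' j) = U.of r s (.w' j) * U.of r s (.w i) := by
  simpa [U.of] using U.proj_rel (Rel.w_w' (r := r) (s := s) i j)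

lemma U.w'_w' (i j : Fin (n - 1)) :
    U.of r s (.w' i) * U.of r s (.w' j) = U.of r s (.w' j) * U.of r s (.w' i) := by
  simpa [U.of] using U.proj_rel (Rel.w'_w' (r := r) (s := s) i j)

lemma U.w_e (i j : Fin (n - 1)) : U.of r s (.w i) * U.of r s (.e j)
    = chi r s (simpleRoot j) i • (U.of r s (.e j) * U.of r s (.w i)) := by
  simpa [U.of] using U.proj_rel (Rel.w_e (r := r) (s := s) i j)

lemma U.w_f (i j : Fin (n - 1)) : U.of r s (.w i) * U.of r s (.f j)
    = chi r s (-simpleRoot j) i • (U.of r s (.f j) * U.of r s (.w i)) := by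
  simpa [U.of] using U.proj_rel (Rel.w_f (r := r) (s := s) i j)

lemma U.w'_e (i j : Fin (n - 1)) : U.of r s (.w' i) * U.of r s (.e j)
    = chi' r s (simpleRoot j) i • (U.of r s (.e j) * U.of r s (.w' i)) := by
  simpa [U.of] using U.proj_rel (Rel.w'_e (r := r) (s := s) i j)

lemma U.w'_f (i j : Fin (n - 1)) : U.of r s (.w' i) * U.of r s (.f j)
    = chi' r s (-simpleRoot j) i • (U.of r s (.f j) * U.of r s (.w' i)) := by
  simpa [U.of] using U.proj_rel (Rel.w'_f (r := r) (s := s) i j)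

lemma U.e_f_same (i : Fin (n - 1)) :
    U.of r s (.e i) * U.of r s (.f i) - U.of r s (.f i) * U.of r s (.e i)
      = (r - s)⁻¹ • (U.of r s (.w i) - U.of r s (.w' i)) := by
  simpa [U.of] using U.proj_rel (Rel.e_f_same (r := r) (s := s) i)

lemma U.e_f_ne {i j : Fin (n - 1)} (h : i ≠ j) :
    U.of r s (.e i) * U.of r s (.f j) = U.of r s (.f j) * U.of r s (.e i) := by
  simpa [U.of] using U.proj_rel (Rel.e_f_ne (r := r) (s := s) i j h)

lemma U.e_e {i j : Fin (n - 1)} (h : i.val + 1 < j.val) :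
    U.of r s (.e i) * U.of r s (.e j) = U.of r s (.e j) * U.of r s (.e i) := by
  simpa [U.of] using U.proj_rel (Rel.e_e (r := r) (s := s) i j h)

lemma U.f_f {i j : Fin (n - 1)} (h : i.val + 1 < j.val) :
    U.of r s (.f i) * U.of r s (.f j) = U.of r s (.f j) * U.of r s (.f i) := by
  simpa [U.of] using U.proj_rel (Rel.f_f (r := r) (s := s) i j h)

lemma U.serre_e₁ {i j : Fin (n - 1)} (h : j.val = i.val + 1) :
    U.of r s (.e i) ^ 2 * U.of r s (.e j)
      - (r + s) • (U.of r s (.e i) * U.of r s (.e j) * U.of r s (.e i))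
      + (r * s) • (U.of r s (.e j) * U.of r s (.e i) ^ 2) = 0 := by
  simpa only [U.of, map_add, map_sub, map_mul, map_pow, map_smul, map_zero]
    using U.proj_rel (Rel.serre_e₁ (r := r) (s := s) i j h)

lemma U.serre_e₂ {i j : Fin (n - 1)} (h : j.val = i.val + 1) :
    U.of r s (.e i) * U.of r s (.e j) ^ 2
      - (r + s) • (U.of r s (.e j) * U.of r s (.e i) * U.of r s (.e j))
      + (r * s) • (U.of r s (.e j) ^ 2 * U.of r s (.e i)) = 0 := by
  simpa only [U.of, map_add, map_sub, map_mul, map_pow, map_smul, map_zero]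
    using U.proj_rel (Rel.serre_e₂ (r := r) (s := s) i j h)

lemma U.serre_f₁ {i j : Fin (n - 1)} (h : j.val = i.val + 1) :
    U.of r s (.f i) ^ 2 * U.of r s (.f j)
      - (r⁻¹ + s⁻¹) • (U.of r s (.f i) * U.of r s (.f j) * U.of r s (.f i))
      + (r⁻¹ * s⁻¹) • (U.of r s (.f j) * U.of r s (.f i) ^ 2) = 0 := by
  simpa only [U.of, map_add, map_sub, map_mul, map_pow, map_smul, map_zero]
    using U.proj_rel (Rel.serre_f₁ (r := r) (s := s) i j h)

lemma U.serre_f₂ {i j : Fin (n - 1)} (h : j.val = i.val + 1) :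
    U.of r s (.f i) * U.of r s (.f j) ^ 2
      - (r⁻¹ + s⁻¹) • (U.of r s (.f j) * U.of r s (.f i) * U.of r s (.f j))
      + (r⁻¹ * s⁻¹) • (U.of r s (.f j) ^ 2 * U.of r s (.f i)) = 0 := by
  simpa only [U.of, map_add, map_sub, map_mul, map_pow, map_smul, map_zero]
    using U.proj_rel (Rel.serre_f₂ (r := r) (s := s) i j h)

end relations

section serre

variable {A : Type} [Ring A] [Algebra ℂ A]

/-- Expansion of a Serre relation for sums of elements that commute up to scalars. -/
lemma serre_add {x y : ℂ} (hx : x ≠ 0) (hy : y ≠ 0) {a b c d : A}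
    (hba : b * a = (x / y) • (a * b)) (hbc : b * c = y • (c * b)) (hda : d * a = x⁻¹ • (a * d))
    (h₁ : a ^ 2 * c - (x + y) • (a * c * a) + (x * y) • (c * a ^ 2) = 0)
    (h₂ : b ^ 2 * d - (x + y) • (b * d * b) + (x * y) • (d * b ^ 2) = 0) :
    (a + b) ^ 2 * (c + d) - (x + y) • ((a + b) * (c + d) * (a + b))
      + (x * y) • ((c + d) * (a + b) ^ 2) = 0 := by
  have hba' (z : A) : b * (a * z) = (x / y) • (a * (b * z)) := by
    rw [← mul_assoc, hba, smul_mul_assoc, mul_assoc]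
  have hbc' (z : A) : b * (c * z) = y • (c * (b * z)) := by
    rw [← mul_assoc, hbc, smul_mul_assoc, mul_assoc]
  have hda' (z : A) : d * (a * z) = x⁻¹ • (a * (d * z)) := by
    rw [← mul_assoc, hda, smul_mul_assoc, mul_assoc]
  refine Eq.trans (b := (a ^ 2 * c - (x + y) • (a * c * a) + (x * y) • (c * a ^ 2))
    + (b ^ 2 * d - (x + y) • (b * d * b) + (x * y) • (d * b ^ 2))) ?_ (by rw [h₁, h₂, add_zero])
  simp only [pow_two, mul_add, add_mul, mul_assoc, hba, hbc, hda, hba', hbc', hda',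
    mul_smul_comm, smul_mul_assoc, smul_smul]
  match_scalars <;> field_simp <;> ring

lemma serre_swap {x y : ℂ} (hx : x ≠ 0) (hy : y ≠ 0) {a c : A} :
    c * a ^ 2 - (x + y) • (a * c * a) + (x * y) • (a ^ 2 * c) = 0 ↔
      a ^ 2 * c - (y⁻¹ + x⁻¹) • (a * c * a) + (y⁻¹ * x⁻¹) • (c * a ^ 2) = 0 := by
  rw [← smul_eq_zero_iff_right (mul_ne_zero hx hy) (m := a ^ 2 * c - _ + _)]
  refine Eq.congr_left ?_
  match_scalars <;> field_simp

end serre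

lemma chi_lemma {n : ℕ} (r s : ℂ) (i j : Fin (n - 1)) :
    chi' r s (simpleRoot i) j = chi r s (-simpleRoot j) i := by
  unfold chi chi' eps simpleRoot eps
  congr 2
  · simp [Pi.single_apply, hi, lo, Fin.ext_iff]
    grind
  · simp [Pi.single_apply, hi, lo, Fin.ext_iff]
    grind

lemma chi_same {n : ℕ} (r s : ℂ) (i : Fin (n - 1)) :
    chi r s (simpleRoot i) i = r / s := by
  simp [chi, eps, simpleRoot, hi, lo, div_eq_mul_inv]

lemma chi_succ {n : ℕ} (r s : ℂ) {i j : Fin (n - 1)} (h : j.val = i.val + 1) :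
    chi r s (simpleRoot j) i = s := by
  simp [chi, eps, simpleRoot, hi, lo, h, add_assoc]

lemma chi_pred {n : ℕ} (r s : ℂ) {i j : Fin (n - 1)} (h : j.val = i.val + 1) :
    chi r s (simpleRoot i) j = r⁻¹ := by
  simp [chi, eps, simpleRoot, hi, lo, h, add_assoc]

lemma chi'_same {n : ℕ} (r s : ℂ) (i : Fin (n - 1)) :
    chi' r s (-simpleRoot i) i = r / s := by
  simp [chi', eps, simpleRoot, hi, lo, div_eq_mul_inv]

lemma chi'_succ {n : ℕ} (r s : ℂ) {i j : Fin (n - 1)} (h : j.val = i.val + 1) :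
    chi' r s (-simpleRoot j) i = r⁻¹ := by
  simp [chi', eps, simpleRoot, hi, lo, h, add_assoc]

lemma chi'_pred {n : ℕ} (r s : ℂ) {i j : Fin (n - 1)} (h : j.val = i.val + 1) :
    chi' r s (-simpleRoot i) j = s := by
  simp [chi', eps, simpleRoot, hi, lo, h, add_assoc]

lemma coprod_rel {n : ℕ} (p : Params) ⦃x y : FreeAlgebra ℂ (Gen n)⦄ (h : Rel n p.r p.s x y) :
    FreeAlgebra.lift ℂ (coprodGen p.r p.s) x = FreeAlgebra.lift ℂ (coprodGen p.r p.s) y := by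
  have hr := p.r_ne_zero
  have hs := p.s_ne_zero
  cases h with
  | w_mul_inv i =>
    simp [gen, coprodGen, U.w_mul_inv, Algebra.TensorProduct.one_def]
  | inv_mul_w i => simp [gen, coprodGen, U.inv_mul_w, Algebra.TensorProduct.one_def]
  | w'_mul_inv i => simp [gen, coprodGen, U.w'_mul_inv, Algebra.TensorProduct.one_def]
  | inv_mul_w' i => simp [gen, coprodGen, U.inv_mul_w', Algebra.TensorProduct.one_def]
  | w_w i j => simp [gen, coprodGen, U.w_w i j]
  | w_w' i j => simp [gen, coprodGen, U.w_w' i j]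
  | w'_w' i j => simp [gen, coprodGen, U.w'_w' i j]
  | w_e i j =>
    simp [gen, coprodGen, mul_add, add_mul, U.w_e i j, U.w_w i j, TensorProduct.smul_tmul']
  | w_f i j =>
    simp [gen, coprodGen, mul_add, add_mul, U.w_f i j, U.w_w' i j, TensorProduct.smul_tmul']
  | w'_e i j =>
    simp [gen, coprodGen, mul_add, add_mul, U.w'_e i j, ← U.w_w' j i, TensorProduct.smul_tmul']
  | w'_f i j =>
    simp [gen, coprodGen, mul_add, add_mul, U.w'_f i j, U.w'_w' i j, TensorProduct.smul_tmul']
  | e_f_same i =>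
    have h1 := eq_add_of_sub_eq (U.e_f_same (r := p.r) (s := p.s) i)
    simp only [gen, coprodGen, map_sub, map_mul, map_smul, FreeAlgebra.lift_ι_apply, mul_add,
      add_mul, Algebra.TensorProduct.tmul_mul_tmul, one_mul, mul_one, U.w_f, U.w'_e, h1,
      TensorProduct.add_tmul, TensorProduct.tmul_add, TensorProduct.sub_tmul,
      TensorProduct.tmul_sub, TensorProduct.tmul_smul, TensorProduct.smul_tmul', smul_sub,
      chi_lemma]
    abel
  | e_f_ne i j hij =>
    simp only [gen, coprodGen, map_mul, FreeAlgebra.lift_ι_apply, mul_add,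
      add_mul, Algebra.TensorProduct.tmul_mul_tmul, one_mul, mul_one, U.w_f, U.w'_e,
      U.e_f_ne hij, TensorProduct.tmul_smul, TensorProduct.smul_tmul', chi_lemma]
    abel
  | e_e i j hij =>
    have h1 : chi p.r p.s (simpleRoot j) i = 1 := by
      have e2 : ¬ j.val = i.val := by omega
      have e4 : ¬ j.val + 1 = i.val := by omega
      have e6 : ¬ j.val = i.val + 1 := by omega
      simp [chi, eps, simpleRoot, hi, lo, e2, e4, e6]
    have h2 : chi p.r p.s (simpleRoot i) j = 1 := by
      have e1 : ¬ i.val = j.val := by omega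
      have e3 : ¬ i.val + 1 = j.val := by omega
      have e5 : ¬ i.val = j.val + 1 := by omega
      simp [chi, eps, simpleRoot, hi, lo, e1, e3, e5]
    simp only [gen, coprodGen, map_mul, FreeAlgebra.lift_ι_apply, mul_add,
      add_mul, Algebra.TensorProduct.tmul_mul_tmul, one_mul, mul_one, U.w_e, U.e_e hij,
      U.w_w i j, h1, h2, one_smul]
    abel
  | f_f i j hij =>
    have h1 : chi' p.r p.s (-simpleRoot j) i = 1 := by
      have e2 : ¬ j.val = i.val := by omega
      have e4 : ¬ j.val + 1 = i.val := by omega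
      have e6 : ¬ j.val = i.val + 1 := by omega
      simp [chi', eps, simpleRoot, hi, lo, e2, e4, e6]
    have h2 : chi' p.r p.s (-simpleRoot i) j = 1 := by
      have e1 : ¬ i.val = j.val := by omega
      have e3 : ¬ i.val + 1 = j.val := by omega
      have e5 : ¬ i.val = j.val + 1 := by omega
      simp [chi', eps, simpleRoot, hi, lo, e1, e3, e5]
    simp only [gen, coprodGen, map_mul, FreeAlgebra.lift_ι_apply, mul_add,
      add_mul, Algebra.TensorProduct.tmul_mul_tmul, one_mul, mul_one, U.w'_f, U.f_f hij,
      U.w'_w' i j, h1, h2, one_smul]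
    abel
  | serre_e₁ i j hij =>
    simp only [gen, coprodGen, map_add, map_sub, map_mul, map_pow, map_smul, map_zero,
      FreeAlgebra.lift_ι_apply]
    have h0 := U.serre_e₁ (r := p.r) (s := p.s) hij
    apply serre_add hr hs
    · simp [U.w_e, chi_same, TensorProduct.smul_tmul']
    · simp [U.w_e, chi_succ _ _ hij, TensorProduct.smul_tmul']
    · simp [U.w_e, chi_pred _ _ hij, TensorProduct.smul_tmul']
    · simpa [TensorProduct.smul_tmul', TensorProduct.add_tmul, TensorProduct.sub_tmul] using
        congr($h0 ⊗ₜ[ℂ] (1 : U n p.r p.s))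
    · have h2 : U.of p.r p.s (.w i) * U.of p.r p.s (.w j) * U.of p.r p.s (.w i)
          = U.of p.r p.s (.w i) ^ 2 * U.of p.r p.s (.w j) := by
        rw [mul_assoc, U.w_w j i, ← mul_assoc, pow_two]
      have h3 : U.of p.r p.s (.w j) * U.of p.r p.s (.w i) ^ 2
          = U.of p.r p.s (.w i) ^ 2 * U.of p.r p.s (.w j) := by
        rw [pow_two, ← mul_assoc, U.w_w j i, h2, pow_two]
      simpa [h2, h3, TensorProduct.tmul_add, TensorProduct.tmul_sub] using
        congr((U.of p.r p.s (.w i) ^ 2 * U.of p.r p.s (.w j)) ⊗ₜ[ℂ] $h0)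
  | serre_e₂ i j hij =>
    simp only [gen, coprodGen, map_add, map_sub, map_mul, map_pow, map_smul, map_zero,
      FreeAlgebra.lift_ι_apply]
    have h0 := U.serre_e₂ (r := p.r) (s := p.s) hij
    rw [serre_swap hr hs] at h0 ⊢
    apply serre_add (inv_ne_zero hs) (inv_ne_zero hr)
    · simp [U.w_e, chi_same, TensorProduct.smul_tmul', div_eq_mul_inv, mul_comm]
    · simp [U.w_e, chi_pred _ _ hij, TensorProduct.smul_tmul']
    · simp [U.w_e, chi_succ _ _ hij, TensorProduct.smul_tmul']
    · simpa [TensorProduct.smul_tmul', TensorProduct.add_tmul, TensorProduct.sub_tmul] using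
        congr($h0 ⊗ₜ[ℂ] (1 : U n p.r p.s))
    · have h2 : U.of p.r p.s (.w j) * U.of p.r p.s (.w i) * U.of p.r p.s (.w j)
          = U.of p.r p.s (.w j) ^ 2 * U.of p.r p.s (.w i) := by
        rw [mul_assoc, U.w_w i j, ← mul_assoc, pow_two]
      have h3 : U.of p.r p.s (.w i) * U.of p.r p.s (.w j) ^ 2
          = U.of p.r p.s (.w j) ^ 2 * U.of p.r p.s (.w i) := by
        rw [pow_two, ← mul_assoc, U.w_w i j, h2, pow_two]
      simpa [h2, h3, TensorProduct.tmul_add, TensorProduct.tmul_sub] using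
        congr((U.of p.r p.s (.w j) ^ 2 * U.of p.r p.s (.w i)) ⊗ₜ[ℂ] $h0)
  | serre_f₁ i j hij =>
    simp only [gen, coprodGen, map_add, map_sub, map_mul, map_pow, map_smul, map_zero,
      FreeAlgebra.lift_ι_apply]
    have h0 := U.serre_f₁ (r := p.r) (s := p.s) hij
    rw [add_comm p.r⁻¹, mul_comm p.r⁻¹] at h0 ⊢
    apply serre_add (inv_ne_zero hs) (inv_ne_zero hr)
    · simp [U.w'_f, chi'_same, TensorProduct.smul_tmul', div_eq_mul_inv, mul_comm]
    · simp [U.w'_f, chi'_succ _ _ hij, TensorProduct.smul_tmul']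
    · simp [U.w'_f, chi'_pred _ _ hij, TensorProduct.smul_tmul']
    · simpa [TensorProduct.tmul_add, TensorProduct.tmul_sub] using
        congr((1 : U n p.r p.s) ⊗ₜ[ℂ] $h0)
    · have h2 : U.of p.r p.s (.w' i) * U.of p.r p.s (.w' j) * U.of p.r p.s (.w' i)
          = U.of p.r p.s (.w' i) ^ 2 * U.of p.r p.s (.w' j) := by
        rw [mul_assoc, U.w'_w' j i, ← mul_assoc, pow_two]
      have h3 : U.of p.r p.s (.w' j) * U.of p.r p.s (.w' i) ^ 2
          = U.of p.r p.s (.w' i) ^ 2 * U.of p.r p.s (.w' j) := by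
        rw [pow_two, ← mul_assoc, U.w'_w' j i, h2, pow_two]
      simpa [h2, h3, TensorProduct.add_tmul, TensorProduct.sub_tmul, TensorProduct.smul_tmul']
        using congr($h0 ⊗ₜ[ℂ] (U.of p.r p.s (.w' i) ^ 2 * U.of p.r p.s (.w' j)))
  | serre_f₂ i j hij =>
    simp only [gen, coprodGen, map_add, map_sub, map_mul, map_pow, map_smul, map_zero,
      FreeAlgebra.lift_ι_apply]
    have h0 := U.serre_f₂ (r := p.r) (s := p.s) hij
    rw [add_comm p.r⁻¹, mul_comm p.r⁻¹] at h0 ⊢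
    rw [serre_swap (inv_ne_zero hs) (inv_ne_zero hr), inv_inv, inv_inv] at h0 ⊢
    apply serre_add hr hs
    · simp [U.w'_f, chi'_same, TensorProduct.smul_tmul']
    · simp [U.w'_f, chi'_pred _ _ hij, TensorProduct.smul_tmul']
    · simp [U.w'_f, chi'_succ _ _ hij, TensorProduct.smul_tmul']
    · simpa [TensorProduct.tmul_add, TensorProduct.tmul_sub] using
        congr((1 : U n p.r p.s) ⊗ₜ[ℂ] $h0)
    · have h2 : U.of p.r p.s (.w' j) * U.of p.r p.s (.w' i) * U.of p.r p.s (.w' j)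
          = U.of p.r p.s (.w' j) ^ 2 * U.of p.r p.s (.w' i) := by
        rw [mul_assoc, U.w'_w' i j, ← mul_assoc, pow_two]
      have h3 : U.of p.r p.s (.w' i) * U.of p.r p.s (.w' j) ^ 2
          = U.of p.r p.s (.w' j) ^ 2 * U.of p.r p.s (.w' i) := by
        rw [pow_two, ← mul_assoc, U.w'_w' i j, h2, pow_two]
      simpa [h2, h3, TensorProduct.add_tmul, TensorProduct.sub_tmul, TensorProduct.smul_tmul']
        using congr($h0 ⊗ₜ[ℂ] (U.of p.r p.s (.w' j) ^ 2 * U.of p.r p.s (.w' i)))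

/-- The coproduct of `U_{r,s}(sl_n)`. -/
def coprod (n : ℕ) (p : Params) : U n p.r p.s →ₐ[ℂ] U n p.r p.s ⊗[ℂ] U n p.r p.s :=
  U.lift (coprodGen p.r p.s) (coprod_rel p)

/-! ### The natural representation and its tensor powers -/

/-- The space `V` with basis `v₁, …, vₙ`. -/
abbrev V (n : ℕ) : Type := Fin n → ℂ

/-- The basis vectors of `V`. -/
def v {n : ℕ} (a : Fin n) : V n := Pi.single a 1

/-- The natural representation on generators: `eⱼ = Eⱼ,ⱼ₊₁`, `fⱼ = Eⱼ₊₁,ⱼ`,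
`ωⱼ = r Eⱼⱼ + s Eⱼ₊₁,ⱼ₊₁ + ∑_{k ≠ j, j+1} Eₖₖ`, `ω'ⱼ = s Eⱼⱼ + r Eⱼ₊₁,ⱼ₊₁ + ∑_{k ≠ j, j+1} Eₖₖ`. -/
def natGen {n : ℕ} (p : Params) : Gen n → Matrix (Fin n) (Fin n) ℂ
  | .e j => Matrix.single (lo j) (hi j) 1
  | .f j => Matrix.single (hi j) (lo j) 1
  | .w j => Matrix.diagonal fun a => if a = lo j then p.r else if a = hi j then p.s else 1
  | .w' j => Matrix.diagonal fun a => if a = lo j then p.s else if a = hi j then p.r else 1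
  | .wInv j => Matrix.diagonal fun a => if a = lo j then p.r⁻¹ else if a = hi j then p.s⁻¹ else 1
  | .wInv' j => Matrix.diagonal fun a => if a = lo j then p.s⁻¹ else if a = hi j then p.r⁻¹ else 1

lemma lo_ne_hi {n : ℕ} (j : Fin (n - 1)) : lo j ≠ hi j := by simp [lo, hi]

lemma lo_inj {n : ℕ} {i j : Fin (n - 1)} : lo i = lo j ↔ i = j := by simp [lo, Fin.ext_iff]

lemma hi_inj {n : ℕ} {i j : Fin (n - 1)} : hi i = hi j ↔ i = j := by simp [hi, Fin.ext_iff]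

lemma chi_diag {n : ℕ} (p : Params) (i j : Fin (n - 1)) :
    (if lo j = lo i then p.r else if lo j = hi i then p.s else 1)
      = chi p.r p.s (simpleRoot j) i *
        (if hi j = lo i then p.r else if hi j = hi i then p.s else 1) := by
  have hr := p.r_ne_zero
  have hs := p.s_ne_zero
  have h1 := lo_ne_hi i
  have h2 := lo_ne_hi j
  rcases eq_or_ne i j with rfl | h3
  · simp [chi, eps, simpleRoot, h1, h1.symm]
    field_simp
  have h4 : lo i ≠ lo j := by rwa [Ne, lo_inj]
  have h5 : hi i ≠ hi j := by rwa [Ne, hi_inj]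
  by_cases h6 : lo j = hi i
  · have h7 : hi j ≠ lo i := by
      simp only [hi, lo, Fin.ext_iff, ne_eq] at h6 ⊢
      omega
    simp [chi, eps, simpleRoot, Pi.single_apply, h1, h2, h4, h5, h6, h7, h1.symm, h2.symm, h4.symm,
      h5.symm, h7.symm]
  · by_cases h7 : hi j = lo i
    · simp [chi, eps, simpleRoot, Pi.single_apply, h1, h2, h4, h5, h6, h7, h1.symm, h2.symm, h4.symm,
        h5.symm, Ne.symm h6, hr, hs]
    · simp [chi, eps, simpleRoot, Pi.single_apply, h1, h2, h4, h5, h6, h7, h1.symm, h2.symm, h4.symm,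
        h5.symm, Ne.symm h6, Ne.symm h7]

lemma chi'_diag {n : ℕ} (p : Params) (i j : Fin (n - 1)) :
    (if lo j = lo i then p.s else if lo j = hi i then p.r else 1)
      = chi' p.r p.s (simpleRoot j) i *
        (if hi j = lo i then p.s else if hi j = hi i then p.r else 1) := by
  have hr := p.r_ne_zero
  have hs := p.s_ne_zero
  have h1 := lo_ne_hi i
  have h2 := lo_ne_hi j
  rcases eq_or_ne i j with rfl | h3
  · simp [chi', eps, simpleRoot, h1, h1.symm]
    field_simp
  have h4 : lo i ≠ lo j := by rwa [Ne, lo_inj]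
  have h5 : hi i ≠ hi j := by rwa [Ne, hi_inj]
  by_cases h6 : lo j = hi i
  · have h7 : hi j ≠ lo i := by
      simp only [hi, lo, Fin.ext_iff, ne_eq] at h6 ⊢
      omega
    simp [chi', eps, simpleRoot, Pi.single_apply, h1, h2, h4, h5, h6, h7, h1.symm, h2.symm, h4.symm,
      h5.symm, h7.symm]
  · by_cases h7 : hi j = lo i
    · simp [chi', eps, simpleRoot, Pi.single_apply, h1, h2, h4, h5, h6, h7, h1.symm, h2.symm, h4.symm,
        h5.symm, Ne.symm h6, hr, hs]
    · simp [chi', eps, simpleRoot, Pi.single_apply, h1, h2, h4, h5, h6, h7, h1.symm, h2.symm, h4.symm,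
        h5.symm, Ne.symm h6, Ne.symm h7]

lemma chi_diag_neg {n : ℕ} (p : Params) (i j : Fin (n - 1)) :
    (if hi j = lo i then p.r else if hi j = hi i then p.s else 1)
      = chi p.r p.s (-simpleRoot j) i *
        (if lo j = lo i then p.r else if lo j = hi i then p.s else 1) := by
  have hr := p.r_ne_zero
  have hs := p.s_ne_zero
  rw [chi_diag p i j, ← mul_assoc]
  have h : chi p.r p.s (-simpleRoot j) i * chi p.r p.s (simpleRoot j) i = 1 := by
    simp only [chi, dotProduct_neg, zpow_neg]
    field_simp
  rw [h, one_mul]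

lemma chi'_diag_neg {n : ℕ} (p : Params) (i j : Fin (n - 1)) :
    (if hi j = lo i then p.s else if hi j = hi i then p.r else 1)
      = chi' p.r p.s (-simpleRoot j) i *
        (if lo j = lo i then p.s else if lo j = hi i then p.r else 1) := by
  have hr := p.r_ne_zero
  have hs := p.s_ne_zero
  rw [chi'_diag p i j, ← mul_assoc]
  have h : chi' p.r p.s (-simpleRoot j) i * chi' p.r p.s (simpleRoot j) i = 1 := by
    simp only [chi', dotProduct_neg, zpow_neg]
    field_simp
  rw [h, one_mul]

lemma nat_rel {n : ℕ} (p : Params) ⦃x y : FreeAlgebra ℂ (Gen n)⦄ (h : Rel n p.r p.s x y) :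
    FreeAlgebra.lift ℂ (natGen p) x = FreeAlgebra.lift ℂ (natGen p) y := by
  have hr := p.r_ne_zero
  have hs := p.s_ne_zero
  have hrs : p.r - p.s ≠ 0 := sub_ne_zero.2 p.r_ne_s
  cases h with
  | w_mul_inv i =>
    simp only [gen, natGen, map_mul, FreeAlgebra.lift_ι_apply, Matrix.diagonal_mul_diagonal,
      map_one]
    rw [← Matrix.diagonal_one]
    congr 1
    funext a
    split_ifs <;> simp [hr, hs]
  | inv_mul_w i =>
    simp only [gen, natGen, map_mul, FreeAlgebra.lift_ι_apply, Matrix.diagonal_mul_diagonal,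
      map_one]
    rw [← Matrix.diagonal_one]
    congr 1
    funext a
    split_ifs <;> simp [hr, hs]
  | w'_mul_inv i =>
    simp only [gen, natGen, map_mul, FreeAlgebra.lift_ι_apply, Matrix.diagonal_mul_diagonal,
      map_one]
    rw [← Matrix.diagonal_one]
    congr 1
    funext a
    split_ifs <;> simp [hr, hs]
  | inv_mul_w' i =>
    simp only [gen, natGen, map_mul, FreeAlgebra.lift_ι_apply, Matrix.diagonal_mul_diagonal,
      map_one]
    rw [← Matrix.diagonal_one]
    congr 1
    funext a
    split_ifs <;> simp [hr, hs]
  | w_w i j => simp [gen, natGen, mul_comm]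
  | w_w' i j => simp [gen, natGen, mul_comm]
  | w'_w' i j => simp [gen, natGen, mul_comm]
  | w_e i j =>
    ext a b
    simp only [gen, natGen, map_mul, map_smul, FreeAlgebra.lift_ι_apply, Matrix.diagonal_mul,
      Matrix.mul_diagonal, Matrix.single_apply, Matrix.smul_apply, smul_eq_mul]
    by_cases h0 : lo j = a ∧ hi j = b
    · obtain ⟨rfl, rfl⟩ := h0
      simpa using chi_diag p i j
    · simp [h0]
  | w_f i j =>
    ext a b
    simp only [gen, natGen, map_mul, map_smul, FreeAlgebra.lift_ι_apply, Matrix.diagonal_mul,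
      Matrix.mul_diagonal, Matrix.single_apply, Matrix.smul_apply, smul_eq_mul]
    by_cases h0 : hi j = a ∧ lo j = b
    · obtain ⟨rfl, rfl⟩ := h0
      simpa using chi_diag_neg p i j
    · simp [h0]
  | w'_e i j =>
    ext a b
    simp only [gen, natGen, map_mul, map_smul, FreeAlgebra.lift_ι_apply, Matrix.diagonal_mul,
      Matrix.mul_diagonal, Matrix.single_apply, Matrix.smul_apply, smul_eq_mul]
    by_cases h0 : lo j = a ∧ hi j = b
    · obtain ⟨rfl, rfl⟩ := h0
      simpa using chi'_diag p i j
    · simp [h0]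
  | w'_f i j =>
    ext a b
    simp only [gen, natGen, map_mul, map_smul, FreeAlgebra.lift_ι_apply, Matrix.diagonal_mul,
      Matrix.mul_diagonal, Matrix.single_apply, Matrix.smul_apply, smul_eq_mul]
    by_cases h0 : hi j = a ∧ lo j = b
    · obtain ⟨rfl, rfl⟩ := h0
      simpa using chi'_diag_neg p i j
    · simp [h0]
  | e_f_same i =>
    ext a b
    have := lo_ne_hi i
    simp only [gen, natGen, map_mul, map_sub, map_smul, FreeAlgebra.lift_ι_apply,
      Matrix.single_mul_single_same, Matrix.single_apply, Matrix.smul_apply, smul_eq_mul,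
      Matrix.sub_apply, Matrix.diagonal_apply]
    by_cases hab : a = b
    · subst hab
      by_cases h1 : a = lo i
      · subst h1
        simp [this, this.symm, hrs]
      · by_cases h2 : a = hi i
        · subst h2
          simp only [this, this.symm, and_self, if_true, if_false]
          field_simp
          ring
        · simp [h1, h2, Ne.symm h1, Ne.symm h2, eq_comm]
    · have h1 (c : Fin n) : ¬ (c = a ∧ c = b) := fun h => hab (h.1.symm.trans h.2)
      simp [hab, h1]
  | e_f_ne i j hij =>
    simp [gen, natGen, Matrix.single_mul_single_of_ne, hi_inj, lo_inj, hij, hij.symm]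
  | e_e i j hij =>
    have h1 : hi i ≠ lo j := by simp [hi, lo]; omega
    have h2 : hi j ≠ lo i := by simp [hi, lo]; omega
    simp [gen, natGen, Matrix.single_mul_single_of_ne, h1, h2]
  | f_f i j hij =>
    have h1 : hi i ≠ lo j := by simp [hi, lo]; omega
    have h2 : hi j ≠ lo i := by simp [hi, lo]; omega
    simp [gen, natGen, Matrix.single_mul_single_of_ne, h1.symm, h2.symm]
  | serre_e₁ i j hij =>
    have h1 : lo j = hi i := by simp [hi, lo, hij]
    have h2 : hi j ≠ lo i := by simp [hi, lo]; omega
    have h3 : hi i ≠ hi j := by simp [hi]; omega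
    have h4 : hi i ≠ lo i := (lo_ne_hi i).symm
    simp [gen, natGen, h1, h2, h3, h4, h2.symm, h3.symm, h4.symm, pow_two]
  | serre_e₂ i j hij =>
    have h1 : lo j = hi i := by simp [hi, lo, hij]
    have h2 : hi j ≠ lo i := by simp [hi, lo]; omega
    have h3 : hi i ≠ hi j := by simp [hi]; omega
    have h4 : hi i ≠ lo i := (lo_ne_hi i).symm
    simp [gen, natGen, h1, h2, h3, h4, h2.symm, h3.symm, h4.symm, pow_two]
  | serre_f₁ i j hij =>
    have h1 : lo j = hi i := by simp [hi, lo, hij]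
    have h2 : hi j ≠ lo i := by simp [hi, lo]; omega
    have h3 : hi i ≠ hi j := by simp [hi]; omega
    have h4 : hi i ≠ lo i := (lo_ne_hi i).symm
    simp [gen, natGen, h1, h2, h3, h4, h2.symm, h3.symm, h4.symm, pow_two]
  | serre_f₂ i j hij =>
    have h1 : lo j = hi i := by simp [hi, lo, hij]
    have h2 : hi j ≠ lo i := by simp [hi, lo]; omega
    have h3 : hi i ≠ hi j := by simp [hi]; omega
    have h4 : hi i ≠ lo i := (lo_ne_hi i).symm
    simp [gen, natGen, h1, h2, h3, h4, h2.symm, h3.symm, h4.symm, pow_two]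

/-- The natural representation of `U_{r,s}(sl_n)` on `V`. -/
def natRep (n : ℕ) (p : Params) : U n p.r p.s →ₐ[ℂ] Module.End ℂ (V n) :=
  (Matrix.toLinAlgEquiv' (R := ℂ) (n := Fin n)).toAlgHom.comp (U.lift (natGen p) (nat_rel p))

/-- The tensor product of two representations, through the coproduct. -/
def tensorRep {n : ℕ} (p : Params) {M N : Type} [AddCommGroup M] [Module ℂ M]
    [AddCommGroup N] [Module ℂ N] (ρ : U n p.r p.s →ₐ[ℂ] Module.End ℂ M)
    (σ : U n p.r p.s →ₐ[ℂ] Module.End ℂ N) : U n p.r p.s →ₐ[ℂ] Module.End ℂ (M ⊗[ℂ] N) :=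
  (Module.endTensorEndAlgHom.comp (Algebra.TensorProduct.map ρ σ)).comp (coprod n p)

/-- The isomorphism `V ⊗ V^{⊗k} ≃ V^{⊗(k+1)}`. -/
def consEquiv (n k : ℕ) : V n ⊗[ℂ] (⨂[ℂ]^k (V n)) ≃ₗ[ℂ] ⨂[ℂ]^(k + 1) (V n) :=
  LinearEquiv.ofLinearMap
    (TensorProduct.lift (PiTensorProduct.lift.toLinearMap ∘ₗ
      (PiTensorProduct.tprod ℂ : MultilinearMap ℂ (fun _ : Fin (k + 1) => V n) _).curryLeft))
    (PiTensorProduct.lift (LinearMap.uncurryLeft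
      { toFun := fun x => (TensorProduct.mk ℂ (V n) (⨂[ℂ]^k (V n)) x).compMultilinearMap
          (PiTensorProduct.tprod ℂ)
        map_add' := fun x y => by ext; simp
        map_smul' := fun c x => by ext; simp }))
    (by
      refine PiTensorProduct.ext (MultilinearMap.ext fun m => ?_)
      simp)
    (by
      ext x m
      simp)

lemma consEquiv_tmul {n k : ℕ} (x : V n) (m : Fin k → V n) :
    consEquiv n k (x ⊗ₜ PiTensorProduct.tprod ℂ m) = PiTensorProduct.tprod ℂ (Fin.cons x m) := by
  simp [consEquiv]

/-- The representation of `U_{r,s}(sl_n)` on `V^{⊗k}`: the counit for `k = 0`, and then through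
`V^{⊗(k+1)} = V ⊗ V^{⊗k}` and the coproduct. -/
def powRep (n : ℕ) (p : Params) : (k : ℕ) → U n p.r p.s →ₐ[ℂ] Module.End ℂ (⨂[ℂ]^k (V n))
  | 0 => (Algebra.ofId ℂ (Module.End ℂ (⨂[ℂ]^0 (V n)))).comp (counit n p.r p.s)
  | k + 1 => ((consEquiv n k).conjAlgEquiv ℂ).toAlgHom.comp
      (tensorRep p (natRep n p) (powRep n p k))

section action

variable {n : ℕ} {p : Params}

lemma coprod_of (g : Gen n) : coprod n p (U.of p.r p.s g) = coprodGen p.r p.s g :=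
  U.lift_of _ _ _

lemma natRep_of (g : Gen n) :
    natRep n p (U.of p.r p.s g) = Matrix.toLinAlgEquiv' (natGen p g) := by
  simp [natRep, U.lift_of]

lemma natRep_e (j : Fin (n - 1)) (a : Fin n) :
    natRep n p (U.of p.r p.s (.e j)) (v a) = if a = hi j then v (lo j) else 0 := by
  rw [natRep_of]
  ext b
  simp only [natGen, v, Matrix.toLinAlgEquiv'_apply, Matrix.mulVec_single_one, Matrix.col_apply,
    Matrix.single_apply]
  split_ifs <;> simp_all [Pi.single_apply]

lemma natRep_f (j : Fin (n - 1)) (a : Fin n) :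
    natRep n p (U.of p.r p.s (.f j)) (v a) = if a = lo j then v (hi j) else 0 := by
  rw [natRep_of]
  ext b
  simp only [natGen, v, Matrix.toLinAlgEquiv'_apply, Matrix.mulVec_single_one, Matrix.col_apply,
    Matrix.single_apply]
  split_ifs <;> simp_all [Pi.single_apply]

lemma diag_v (d : Fin n → ℂ) (a : Fin n) :
    Matrix.toLinAlgEquiv' (Matrix.diagonal d) (v a) = d a • v a := by
  ext b
  simp only [v, Matrix.toLinAlgEquiv'_apply, Matrix.mulVec_diagonal, Pi.single_apply,
    Pi.smul_apply, smul_eq_mul]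
  split_ifs with h
  · rw [h]
  · simp

lemma natRep_w (j : Fin (n - 1)) (a : Fin n) : natRep n p (U.of p.r p.s (.w j)) (v a)
    = (if a = lo j then p.r else if a = hi j then p.s else 1) • v a := by
  rw [natRep_of, natGen, diag_v]

lemma natRep_w' (j : Fin (n - 1)) (a : Fin n) : natRep n p (U.of p.r p.s (.w' j)) (v a)
    = (if a = lo j then p.s else if a = hi j then p.r else 1) • v a := by
  rw [natRep_of, natGen, diag_v]

lemma natRep_wInv (j : Fin (n - 1)) (a : Fin n) : natRep n p (U.of p.r p.s (.wInv j)) (v a)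
    = (if a = lo j then p.r⁻¹ else if a = hi j then p.s⁻¹ else 1) • v a := by
  rw [natRep_of, natGen, diag_v]

lemma natRep_wInv' (j : Fin (n - 1)) (a : Fin n) : natRep n p (U.of p.r p.s (.wInv' j)) (v a)
    = (if a = lo j then p.s⁻¹ else if a = hi j then p.r⁻¹ else 1) • v a := by
  rw [natRep_of, natGen, diag_v]

variable {M N : Type} [AddCommGroup M] [Module ℂ M] [AddCommGroup N] [Module ℂ N]
  (ρ : U n p.r p.s →ₐ[ℂ] Module.End ℂ M) (σ : U n p.r p.s →ₐ[ℂ] Module.End ℂ N)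

lemma endTensor_tmul (a : Module.End ℂ M) (b : Module.End ℂ N) (x : M) (y : N) :
    Module.endTensorEndAlgHom (R := ℂ) (S := ℂ) (A := ℂ) (M := M) (N := N) (a ⊗ₜ b) (x ⊗ₜ y)
      = a x ⊗ₜ b y := rfl

lemma tensorRep_of (g : Gen n) : tensorRep p ρ σ (U.of p.r p.s g) =
    Module.endTensorEndAlgHom (R := ℂ) (S := ℂ) (A := ℂ) (M := M) (N := N) (Algebra.TensorProduct.map ρ σ
      (coprodGen p.r p.s g)) := by
  simp [tensorRep, coprod_of]

lemma tensorRep_e (j : Fin (n - 1)) (x : M) (y : N) :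
    tensorRep p ρ σ (U.of p.r p.s (.e j)) (x ⊗ₜ y) = ρ (U.of p.r p.s (.e j)) x ⊗ₜ y
      + ρ (U.of p.r p.s (.w j)) x ⊗ₜ σ (U.of p.r p.s (.e j)) y := by
  simp only [tensorRep_of, coprodGen, map_add, Algebra.TensorProduct.map_tmul, map_one,
    LinearMap.add_apply, endTensor_tmul, Module.End.one_apply]

lemma tensorRep_f (j : Fin (n - 1)) (x : M) (y : N) :
    tensorRep p ρ σ (U.of p.r p.s (.f j)) (x ⊗ₜ y) = x ⊗ₜ σ (U.of p.r p.s (.f j)) y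
      + ρ (U.of p.r p.s (.f j)) x ⊗ₜ σ (U.of p.r p.s (.w' j)) y := by
  simp only [tensorRep_of, coprodGen, map_add, Algebra.TensorProduct.map_tmul, map_one,
    LinearMap.add_apply, endTensor_tmul, Module.End.one_apply]

lemma tensorRep_w (j : Fin (n - 1)) (x : M) (y : N) :
    tensorRep p ρ σ (U.of p.r p.s (.w j)) (x ⊗ₜ y) =
      ρ (U.of p.r p.s (.w j)) x ⊗ₜ σ (U.of p.r p.s (.w j)) y := by
  simp only [tensorRep_of, coprodGen, map_add, Algebra.TensorProduct.map_tmul, map_one,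
    LinearMap.add_apply, endTensor_tmul, Module.End.one_apply]

lemma tensorRep_w' (j : Fin (n - 1)) (x : M) (y : N) :
    tensorRep p ρ σ (U.of p.r p.s (.w' j)) (x ⊗ₜ y) =
      ρ (U.of p.r p.s (.w' j)) x ⊗ₜ σ (U.of p.r p.s (.w' j)) y := by
  simp only [tensorRep_of, coprodGen, map_add, Algebra.TensorProduct.map_tmul, map_one,
    LinearMap.add_apply, endTensor_tmul, Module.End.one_apply]

lemma tensorRep_wInv (j : Fin (n - 1)) (x : M) (y : N) :
    tensorRep p ρ σ (U.of p.r p.s (.wInv j)) (x ⊗ₜ y) =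
      ρ (U.of p.r p.s (.wInv j)) x ⊗ₜ σ (U.of p.r p.s (.wInv j)) y := by
  simp only [tensorRep_of, coprodGen, map_add, Algebra.TensorProduct.map_tmul, map_one,
    LinearMap.add_apply, endTensor_tmul, Module.End.one_apply]

lemma tensorRep_wInv' (j : Fin (n - 1)) (x : M) (y : N) :
    tensorRep p ρ σ (U.of p.r p.s (.wInv' j)) (x ⊗ₜ y) =
      ρ (U.of p.r p.s (.wInv' j)) x ⊗ₜ σ (U.of p.r p.s (.wInv' j)) y := by
  simp only [tensorRep_of, coprodGen, map_add, Algebra.TensorProduct.map_tmul, map_one,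
    LinearMap.add_apply, endTensor_tmul, Module.End.one_apply]

lemma powRep_cons (k : ℕ) (u : U n p.r p.s) (τ : V n ⊗[ℂ] (⨂[ℂ]^k (V n))) :
    powRep n p (k + 1) u (consEquiv n k τ)
      = consEquiv n k (tensorRep p (natRep n p) (powRep n p k) u τ) := by
  simp [powRep]

end action

/-! ### The `(r,s)`-symmetric tensors and the `(r,s)`-wedge modules -/

/-- The space `S²_{r,s}(V)`, spanned by the `vᵢ ⊗ vᵢ` and the `vᵢ ⊗ vⱼ + s vⱼ ⊗ vᵢ`, `i < j`. -/
def symSq (n : ℕ) (p : Params) : Submodule ℂ (V n ⊗[ℂ] V n) :=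
  Submodule.span ℂ ({t | ∃ i : Fin n, t = v i ⊗ₜ v i} ∪
    {t | ∃ i j : Fin n, i < j ∧ t = v i ⊗ₜ v j + p.s • (v j ⊗ₜ v i)})

/-- The map `V ⊗ V → V^{⊗k}` that puts a tensor `x ⊗ y` at the positions `i`, `i + 1` (counted
from `0`) of the pure tensor `m`. -/
def insertPair {n k : ℕ} (i : ℕ) (hi : i + 1 < k) (m : Fin k → V n) :
    V n ⊗[ℂ] V n →ₗ[ℂ] ⨂[ℂ]^k (V n) :=
  TensorProduct.lift (LinearMap.mk₂ ℂ
    (fun x y => PiTensorProduct.tprod ℂ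
      (Function.update (Function.update m ⟨i, by omega⟩ x) ⟨i + 1, hi⟩ y))
    (fun x x' y => by
      simp only [Function.update_comm (show (⟨i, by omega⟩ : Fin k) ≠ ⟨i + 1, hi⟩ by simp)]
      exact MultilinearMap.map_update_add _ _ _ _ _)
    (fun c x y => by
      simp only [Function.update_comm (show (⟨i, by omega⟩ : Fin k) ≠ ⟨i + 1, hi⟩ by simp)]
      exact MultilinearMap.map_update_smul _ _ _ _ _)
    (fun x y y' => MultilinearMap.map_update_add _ _ _ _ _)
    (fun c x y => MultilinearMap.map_update_smul _ _ _ _ _))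

/-- The subspace `V^{⊗i} ⊗ S²_{r,s}(V) ⊗ V^{⊗(k-i-2)}` of `V^{⊗k}`. -/
def symAt (n : ℕ) (p : Params) (k i : ℕ) (hi : i + 1 < k) : Submodule ℂ (⨂[ℂ]^k (V n)) :=
  ⨆ m : Fin k → V n, (symSq n p).map (insertPair i hi m)

/-- The subspace `∑_{i=0}^{k-2} V^{⊗i} ⊗ S²_{r,s}(V) ⊗ V^{⊗(k-i-2)}` of `V^{⊗k}`. -/
def symSum (n : ℕ) (p : Params) (k : ℕ) : Submodule ℂ (⨂[ℂ]^k (V n)) :=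
  ⨆ (i : ℕ) (hi : i + 1 < k), symAt n p k i hi

section invariance

variable {n : ℕ} {p : Params}

/-- `V^{⊗k}` with two factors added on the left. -/
def consTwo (n k : ℕ) : (V n ⊗[ℂ] V n) ⊗[ℂ] (⨂[ℂ]^k (V n)) →ₗ[ℂ] ⨂[ℂ]^(k + 2) (V n) :=
  (consEquiv n (k + 1)).toLinearMap ∘ₗ (consEquiv n k).toLinearMap.lTensor (V n) ∘ₗ
    (TensorProduct.assoc ℂ (V n) (V n) (⨂[ℂ]^k (V n))).toLinearMap

lemma consTwo_tmul {k : ℕ} (x y : V n) (z : ⨂[ℂ]^k (V n)) :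
    consTwo n k ((x ⊗ₜ y) ⊗ₜ z) = consEquiv n (k + 1) (x ⊗ₜ consEquiv n k (y ⊗ₜ z)) := by
  simp [consTwo]

lemma insertPair_tmul {k : ℕ} (i : ℕ) (hi : i + 1 < k) (m : Fin k → V n) (x y : V n) :
    insertPair i hi m (x ⊗ₜ y) = PiTensorProduct.tprod ℂ
      (Function.update (Function.update m ⟨i, by omega⟩ x) ⟨i + 1, hi⟩ y) := by
  simp [insertPair]

lemma insertPair_succ {k : ℕ} (i : ℕ) (hi : i + 1 < k) (x : V n) (m : Fin k → V n)
    (t : V n ⊗[ℂ] V n) :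
    insertPair (i + 1) (by omega) (Fin.cons x m : Fin (k + 1) → V n) t
      = consEquiv n k (x ⊗ₜ insertPair i hi m t) := by
  induction t with
  | zero => simp
  | add a b iha ihb => rw [map_add, map_add, iha, ihb, TensorProduct.tmul_add, map_add]
  | tmul a b =>
    rw [insertPair_tmul, insertPair_tmul, consEquiv_tmul, Fin.cons_update, Fin.cons_update]
    rfl

lemma insertPair_zero {k : ℕ} (x y : V n) (m : Fin k → V n) (t : V n ⊗[ℂ] V n) :
    insertPair 0 (by omega) (Fin.cons x (Fin.cons y m : Fin (k + 1) → V n) : Fin (k + 2) → V n) t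
      = consTwo n k (t ⊗ₜ PiTensorProduct.tprod ℂ m) := by
  induction t with
  | zero => simp
  | add a b iha ihb => rw [map_add, iha, ihb, TensorProduct.add_tmul, map_add]
  | tmul a b =>
    rw [insertPair_tmul, consTwo_tmul, consEquiv_tmul, consEquiv_tmul]
    congr 1
    funext c
    refine Fin.cases ?_ (fun c => Fin.cases ?_ (fun c => ?_) c) c
    · rw [Function.update_of_ne (by simp [Fin.ext_iff])]
      exact Function.update_self _ _ _
    · exact Function.update_self _ _ _
    · rw [Function.update_of_ne (by simp [Fin.ext_iff]),
        Function.update_of_ne (by simp [Fin.ext_iff])]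
      rfl

lemma insertPair_mem {k : ℕ} (i : ℕ) (hi : i + 1 < k) (m : Fin k → V n) {t : V n ⊗[ℂ] V n}
    (ht : t ∈ symSq n p) : insertPair i hi m t ∈ symSum n p k :=
  Submodule.mem_iSup_of_mem i <| Submodule.mem_iSup_of_mem hi <| Submodule.mem_iSup_of_mem m <|
    Submodule.mem_map_of_mem ht

lemma symSum_le {k : ℕ} {N : Submodule ℂ (⨂[ℂ]^k (V n))}
    (h : ∀ (i : ℕ) (hi : i + 1 < k) (m : Fin k → V n), ∀ t ∈ symSq n p, insertPair i hi m t ∈ N) :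
    symSum n p k ≤ N :=
  iSup_le fun i => iSup_le fun hi => iSup_le fun m => by
    rintro _ ⟨t, ht, rfl⟩
    exact h i hi m t ht

lemma cons_mem {k : ℕ} (x : V n) {z : ⨂[ℂ]^k (V n)} (hz : z ∈ symSum n p k) :
    consEquiv n k (x ⊗ₜ z) ∈ symSum n p (k + 1) := by
  have h : symSum n p k ≤ (symSum n p (k + 1)).comap
      ((consEquiv n k).toLinearMap ∘ₗ TensorProduct.mk ℂ (V n) _ x) := by
    refine symSum_le fun i hi m t ht => ?_
    have h1 := insertPair_mem (p := p) (i + 1) (by omega) (Fin.cons x m : Fin (k + 1) → V n) ht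
    rw [insertPair_succ i hi] at h1
    exact h1
  exact h hz

lemma consTwo_mem {k : ℕ} {t : V n ⊗[ℂ] V n} (ht : t ∈ symSq n p) (z : ⨂[ℂ]^k (V n)) :
    consTwo n k (t ⊗ₜ z) ∈ symSum n p (k + 2) := by
  have h (z : ⨂[ℂ]^k (V n)) : z ∈ (symSum n p (k + 2)).comap
      (consTwo n k ∘ₗ TensorProduct.mk ℂ _ _ t) := by
    have hz : z ∈ (⊤ : Submodule ℂ (⨂[ℂ]^k (V n))) := trivial
    rw [← PiTensorProduct.span_tprod_eq_top] at hz
    refine Submodule.span_le.2 ?_ hz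
    rintro _ ⟨m, rfl⟩
    have h1 := insertPair_mem (p := p) 0 (by omega)
      (Fin.cons 0 (Fin.cons 0 m : Fin (k + 1) → V n) : Fin (k + 2) → V n) ht
    rw [insertPair_zero] at h1
    exact h1
  exact h z

/-- `S²_{r,s}(V)` is a submodule of `V ⊗ V`. -/
lemma symSq_invariant (g : Gen n) {t : V n ⊗[ℂ] V n} (ht : t ∈ symSq n p) :
    tensorRep p (natRep n p) (natRep n p) (U.of p.r p.s g) t ∈ symSq n p := by
  have hd (i : Fin n) : (v i ⊗ₜ v i : V n ⊗[ℂ] V n) ∈ symSq n p :=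
    Submodule.subset_span (Or.inl ⟨i, rfl⟩)
  have ho (i j : Fin n) (h : i < j) :
      (v i ⊗ₜ v j + p.s • (v j ⊗ₜ v i) : V n ⊗[ℂ] V n) ∈ symSq n p :=
    Submodule.subset_span (Or.inr ⟨i, j, h, rfl⟩)
  have hc (c c' : ℂ) (i j : Fin n) (h : i < j) : (c • c' • (v i ⊗ₜ v j)
      + p.s • (c' • c • (v j ⊗ₜ v i)) : V n ⊗[ℂ] V n) ∈ symSq n p := by
    convert Submodule.smul_mem _ (c * c') (ho i j h) using 1
    module
  revert t
  change symSq n p ≤ (symSq n p).comap _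
  refine Submodule.span_le.2 ?_
  have hlh (l : Fin (n - 1)) : lo l < hi l := by simp [lo, hi]
  rintro _ (⟨i, rfl⟩ | ⟨i, j, hij, rfl⟩)
  · change tensorRep p (natRep n p) (natRep n p) (U.of p.r p.s g) _ ∈ symSq n p
    cases g with
    | e l =>
      rw [tensorRep_e, natRep_e, natRep_w]
      split_ifs with h1 h2 h2
      · exact absurd (h2.symm.trans h1) (hlh l).ne
      · subst h1
        rw [← TensorProduct.smul_tmul']
        exact ho _ _ (hlh l)
      all_goals simp
    | f l =>
      rw [tensorRep_f, natRep_f, natRep_w']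
      split_ifs with h1 h2
      · subst h1
        rw [TensorProduct.tmul_smul]
        exact ho _ _ (hlh l)
      all_goals simp
    | w l =>
      rw [tensorRep_w, natRep_w, TensorProduct.tmul_smul, ← TensorProduct.smul_tmul']
      exact Submodule.smul_mem _ _ (Submodule.smul_mem _ _ (hd i))
    | w' l =>
      rw [tensorRep_w', natRep_w', TensorProduct.tmul_smul, ← TensorProduct.smul_tmul']
      exact Submodule.smul_mem _ _ (Submodule.smul_mem _ _ (hd i))
    | wInv l =>
      rw [tensorRep_wInv, natRep_wInv, TensorProduct.tmul_smul, ← TensorProduct.smul_tmul']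
      exact Submodule.smul_mem _ _ (Submodule.smul_mem _ _ (hd i))
    | wInv' l =>
      rw [tensorRep_wInv', natRep_wInv', TensorProduct.tmul_smul, ← TensorProduct.smul_tmul']
      exact Submodule.smul_mem _ _ (Submodule.smul_mem _ _ (hd i))
  · change tensorRep p (natRep n p) (natRep n p) (U.of p.r p.s g) _ ∈ symSq n p
    rw [map_add, map_smul]
    cases g with
    | e l =>
      simp only [tensorRep_e, natRep_e, natRep_w]
      by_cases h1 : i = hi l
      · subst h1
        have h2 : j ≠ hi l := hij.ne'
        have h3 : j ≠ lo l := ((hlh l).trans hij).ne'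
        simpa [h2, h3] using ho (lo l) j ((hlh l).trans hij)
      · by_cases h2 : j = hi l
        · subst h2
          by_cases h3 : i = lo l
          · subst h3
            simpa [h1, ← TensorProduct.smul_tmul', ← add_smul] using
              Submodule.smul_mem _ (p.r + p.s) (hd (lo l))
          · have h4 : i < lo l := by
              simp only [lo, hi, Fin.lt_def, Fin.ext_iff] at *
              omega
            simpa [h1, h3] using ho i (lo l) h4
        · simp [h1, h2]
    | f l =>
      simp only [tensorRep_f, natRep_f, natRep_w']
      by_cases h1 : j = lo l
      · subst h1
        have h2 : i ≠ lo l := hij.ne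
        have h3 : i ≠ hi l := (hij.trans (hlh l)).ne
        simpa [h2, h3] using ho i (hi l) (hij.trans (hlh l))
      · by_cases h2 : i = lo l
        · subst h2
          by_cases h3 : j = hi l
          · subst h3
            simpa [h1, ← TensorProduct.smul_tmul', ← add_smul] using
              Submodule.smul_mem _ (p.r + p.s) (hd (hi l))
          · have h4 : hi l < j := by
              simp only [lo, hi, Fin.lt_def, Fin.ext_iff] at *
              omega
            simpa [h1, h3] using ho (hi l) j h4
        · simp [h1, h2]
    | w l =>
      simp only [tensorRep_w, natRep_w, TensorProduct.tmul_smul, ← TensorProduct.smul_tmul']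
      exact hc _ _ i j hij
    | w' l =>
      simp only [tensorRep_w', natRep_w', TensorProduct.tmul_smul, ← TensorProduct.smul_tmul']
      exact hc _ _ i j hij
    | wInv l =>
      simp only [tensorRep_wInv, natRep_wInv, TensorProduct.tmul_smul, ← TensorProduct.smul_tmul']
      exact hc _ _ i j hij
    | wInv' l =>
      simp only [tensorRep_wInv', natRep_wInv', TensorProduct.tmul_smul,
        ← TensorProduct.smul_tmul']
      exact hc _ _ i j hij

lemma powRep_consTwo (k : ℕ) (g : Gen n) (τ : (V n ⊗[ℂ] V n) ⊗[ℂ] (⨂[ℂ]^k (V n))) :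
    powRep n p (k + 2) (U.of p.r p.s g) (consTwo n k τ) = consTwo n k
      (tensorRep p (tensorRep p (natRep n p) (natRep n p)) (powRep n p k) (U.of p.r p.s g) τ) := by
  induction τ with
  | zero => simp
  | add a b iha ihb => rw [map_add, map_add, iha, ihb, map_add, map_add]
  | tmul t z =>
    induction t with
    | zero => simp
    | add a b iha ihb =>
      rw [TensorProduct.add_tmul, map_add, map_add, iha, ihb, map_add, map_add]
    | tmul x y =>
      rw [consTwo_tmul, powRep_cons]
      cases g <;> simp only [tensorRep_e, tensorRep_f, tensorRep_w, tensorRep_w', tensorRep_wInv,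
        tensorRep_wInv', powRep_cons, map_add, consTwo_tmul, TensorProduct.add_tmul,
        TensorProduct.tmul_add]
      all_goals abel

lemma symSum_invariant_gen (k : ℕ) (g : Gen n) {z : ⨂[ℂ]^k (V n)} (hz : z ∈ symSum n p k) :
    powRep n p k (U.of p.r p.s g) z ∈ symSum n p k := by
  induction k generalizing g with
  | zero =>
    have h : symSum n p 0 ≤ ⊥ := symSum_le fun i hi => absurd hi (by omega)
    rw [(Submodule.mem_bot ℂ).1 (h hz), map_zero]
    exact Submodule.zero_mem _
  | succ k ih =>
    revert z
    change symSum n p (k + 1) ≤ (symSum n p (k + 1)).comap _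
    refine symSum_le fun i hi m t ht => ?_
    rw [← Fin.cons_self_tail m]
    change powRep n p (k + 1) (U.of p.r p.s g) _ ∈ symSum n p (k + 1)
    cases i with
    | succ i =>
      have h := insertPair_mem (p := p) i (by omega) (Fin.tail m) ht
      rw [insertPair_succ i (by omega), powRep_cons]
      cases g <;> simp only [tensorRep_e, tensorRep_f, tensorRep_w, tensorRep_w', tensorRep_wInv,
        tensorRep_wInv', map_add]
      · exact add_mem (cons_mem _ h) (cons_mem _ (ih _ h))
      · exact add_mem (cons_mem _ (ih _ h)) (cons_mem _ (ih _ h))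
      all_goals exact cons_mem _ (ih _ h)
    | zero =>
      obtain ⟨k, rfl⟩ : ∃ k', k = k' + 1 := ⟨k - 1, by omega⟩
      rw [← Fin.cons_self_tail (Fin.tail m), insertPair_zero, powRep_consTwo]
      cases g <;> simp only [tensorRep_e (p := p) (tensorRep p _ _),
        tensorRep_f (p := p) (tensorRep p _ _), tensorRep_w (p := p) (tensorRep p _ _),
        tensorRep_w' (p := p) (tensorRep p _ _), tensorRep_wInv (p := p) (tensorRep p _ _),
        tensorRep_wInv' (p := p) (tensorRep p _ _), map_add]
      · exact add_mem (consTwo_mem (symSq_invariant _ ht) _) (consTwo_mem (symSq_invariant _ ht) _)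
      · exact add_mem (consTwo_mem ht _) (consTwo_mem (symSq_invariant _ ht) _)
      all_goals exact consTwo_mem (symSq_invariant _ ht) _

lemma symSum_invariant (k : ℕ) (u : U n p.r p.s) :
    ∀ z ∈ symSum n p k, powRep n p k u z ∈ symSum n p k := by
  refine U.induction (P := fun u => ∀ z ∈ symSum n p k, powRep n p k u z ∈ symSum n p k)
    (fun c z hz => ?_) (fun g z hz => symSum_invariant_gen k g hz)
    (fun a b iha ihb z hz => ?_) (fun a b iha ihb z hz => ?_) u
  · rw [AlgHom.commutes]
    exact Submodule.smul_mem _ c hz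
  · rw [map_mul]
    exact iha _ (ihb z hz)
  · rw [map_add]
    exact add_mem (iha z hz) (ihb z hz)

end invariance

/-- The tensor power `V^{⊗k}` as a `U_{r,s}(sl_n)`-module. -/
def TPow (n : ℕ) (_p : Params) (k : ℕ) : Type := ⨂[ℂ]^k (V n)

instance (n : ℕ) (p : Params) (k : ℕ) : AddCommGroup (TPow n p k) :=
  inferInstanceAs (AddCommGroup (⨂[ℂ]^k (V n)))

instance (n : ℕ) (p : Params) (k : ℕ) : Module (Module.End ℂ (⨂[ℂ]^k (V n))) (TPow n p k) :=
  inferInstanceAs (Module (Module.End ℂ (⨂[ℂ]^k (V n))) (⨂[ℂ]^k (V n)))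

instance (n : ℕ) (p : Params) (k : ℕ) : Module (U n p.r p.s) (TPow n p k) :=
  Module.compHom (TPow n p k) (powRep n p k).toRingHom

/-- The submodule `∑_{i=0}^{k-2} V^{⊗i} ⊗ S²_{r,s}(V) ⊗ V^{⊗(k-i-2)}` of `V^{⊗k}`. -/
def symSubmodule (n : ℕ) (p : Params) (k : ℕ) : Submodule (U n p.r p.s) (TPow n p k) where
  carrier := (symSum n p k : Set (⨂[ℂ]^k (V n)))
  add_mem' := fun ha hb => (symSum n p k).add_mem ha hb
  zero_mem' := (symSum n p k).zero_mem
  smul_mem' := fun u z hz => symSum_invariant k u z hz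

/-- The `k`-th `(r,s)`-wedge module. -/
abbrev Wedge (n : ℕ) (p : Params) (k : ℕ) : Type := TPow n p k ⧸ symSubmodule n p k

/-- The pure tensor `x₁ ⊗ ⋯ ⊗ xₖ` in `V^{⊗k}`. -/
def pureTensor {n : ℕ} (p : Params) {k : ℕ} (x : Fin k → V n) : TPow n p k :=
  PiTensorProduct.tprod ℂ x

/-- The image `v₁ ∧ ⋯ ∧ vₖ` of `v₁ ⊗ ⋯ ⊗ vₖ` in the wedge module. -/
def wedgeTop {n : ℕ} (p : Params) {k : ℕ} (hk : k ≤ n) : Wedge n p k :=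
  (symSubmodule n p k).mkQ (pureTensor p fun j : Fin k => v (Fin.castLE hk j))

/-! ### Highest weight modules -/

/-- `x` is a highest weight vector of weight `μ`: a nonzero vector on which every `ωᵢ`, `ω'ᵢ` acts
by the character of weight `μ` and that every `eᵢ` kills. -/
def IsHighestWeightVector {n : ℕ} {r s : ℂ} {M : Type} [AddCommGroup M] [Module (U n r s) M]
    (μ : Fin n → ℤ) (x : M) : Prop :=
  x ≠ 0 ∧ ∀ i : Fin (n - 1), U.of r s (.e i) • x = 0 ∧
    U.of r s (.w i) • x = algebraMap ℂ (U n r s) (chi r s μ i) • x ∧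
    U.of r s (.w' i) • x = algebraMap ℂ (U n r s) (chi' r s μ i) • x

/-- The left ideal generated by the `eᵢ`, the `ωᵢ - r^⟨εᵢ, μ⟩ s^⟨εᵢ₊₁, μ⟩` and the
`ω'ᵢ - r^⟨εᵢ₊₁, μ⟩ s^⟨εᵢ, μ⟩`. -/
def vermaIdeal {n : ℕ} (r s : ℂ) (μ : Fin n → ℤ) : Submodule (U n r s) (U n r s) :=
  Submodule.span (U n r s) (⋃ i : Fin (n - 1), {U.of r s (.e i),
    U.of r s (.w i) - algebraMap ℂ _ (chi r s μ i),
    U.of r s (.w' i) - algebraMap ℂ _ (chi' r s μ i)})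

/-- The Verma module `M(μ)`. -/
abbrev Verma {n : ℕ} (r s : ℂ) (μ : Fin n → ℤ) : Type := U n r s ⧸ vermaIdeal r s μ

/-- The generator of the Verma module. -/
def vermaGen {n : ℕ} (r s : ℂ) (μ : Fin n → ℤ) : Verma r s μ := (vermaIdeal r s μ).mkQ 1

/-- The sum of all proper submodules of the Verma module `M(μ)`. -/
def vermaRad {n : ℕ} (r s : ℂ) (μ : Fin n → ℤ) : Submodule (U n r s) (Verma r s μ) :=
  sSup {N | N ≠ ⊤}

/-- The simple quotient `V(μ)` of the Verma module `M(μ)`. -/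
abbrev SimpleHW {n : ℕ} (r s : ℂ) (μ : Fin n → ℤ) : Type := Verma r s μ ⧸ vermaRad r s μ

end RSWedge

end

open RSWedge

/-! The module `W_k` is the degree-`k` part of an `(r,s)`-exterior algebra, in which `v_i v_i = 0`
and `v_j v_i = -s⁻¹ v_i v_j` for `i < j`. It is modelled on functions on subsets of `Fin n`: the
indicator of `T` stands for the increasing product of the `v_b` with `b ∈ T`. Left multiplication by
vectors satisfies the two relations (`wedgeMul_self`, `wedgeMul_swap`), so iterating it gives a map
`powToExt` on `V^{⊗k}` that kills `symSum`. Conversely, straightening shows that the increasing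
basis tensors span modulo `symSum` (`mem_sortable`), and their images are distinct indicators. Hence
the kernel is exactly `symSum` (`ker_powToExt`).

In the model, `eᵢ` replaces `hi i` by `lo i` in a subset and `fᵢ` does the reverse, always with
coefficient `1` (`powToExt_e`, `powToExt_f`). Such moves connect every `k`-subset to the initial
one. So a nonzero submodule contains the top vector, and then every basis vector; no condition on
roots of unity enters (`isCoatom_symSubmodule`).

The universal property of the Verma module gives a surjection onto the simple module `W_k`, whose
kernel is maximal. If `r/s` is not a root of unity, the characters of nonempty words in the `fⱼ`
differ from the trivial one, so the generator can be separated from the other words and every proper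
submodule lies in the sum of the images of the `fⱼ` (`exists_sum_f_smul`). The corresponding sum in
`W_k` misses the top vector, so by simplicity every proper submodule maps to zero: the kernel is the
largest proper submodule (`vermaRad_eq_ker`). -/

noncomputable section

namespace RSWedge

/-! ### A model of the `(r,s)`-exterior algebra -/

section model

variable {n : ℕ} {p : Params}

/-- The space with basis the subsets of `Fin n`, a model of the `(r,s)`-exterior algebra. -/
abbrev Ext (n : ℕ) : Type := Finset (Fin n) → ℂ

/-- The scalar produced by moving `v a` to its place in the ordered product of the `v b`, `b ∈ T`. -/
def sortCoeff (p : Params) (a : Fin n) (T : Finset (Fin n)) : ℂ :=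
  ∏ b ∈ T, if b < a then -p.s⁻¹ else 1

lemma sortCoeff_erase {a b : Fin n} (h : ¬ b < a) (T : Finset (Fin n)) :
    sortCoeff p a (T.erase b) = sortCoeff p a T :=
  Finset.prod_erase T (if_neg h)

lemma sortCoeff_eq_of_mem {a b : Fin n} (h : b < a) {T : Finset (Fin n)} (hb : b ∈ T) :
    sortCoeff p a T = -p.s⁻¹ * sortCoeff p a (T.erase b) := by
  rw [sortCoeff, ← Finset.mul_prod_erase T _ hb, if_pos h, sortCoeff]

lemma sortCoeff_insert {a b : Fin n} (h : ¬ b < a) (T : Finset (Fin n)) :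
    sortCoeff p a (insert b T) = sortCoeff p a T :=
  Finset.prod_insert_one (if_neg h)

lemma lo_lt_hi (i : Fin (n - 1)) : lo i < hi i := by simp [lo, hi]

lemma lt_hi_iff {i : Fin (n - 1)} {b : Fin n} : b < hi i ↔ b < lo i ∨ b = lo i := by
  simp only [lo, hi, Fin.lt_def, Fin.ext_iff]
  omega

/-- The only index below `hi i` but not below `lo i` is `lo i` itself. The resulting factor `-s⁻¹`
is what cancels the eigenvalue `s` of `ωᵢ` on `v (hi i)` and of `ω'ᵢ` on `v (lo i)` in the formulas
for `eᵢ` and `fᵢ`. -/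
lemma sortCoeff_hi (i : Fin (n - 1)) (T : Finset (Fin n)) :
    sortCoeff p (hi i) T = if lo i ∈ T then -p.s⁻¹ * sortCoeff p (lo i) T
      else sortCoeff p (lo i) T := by
  have h : sortCoeff p (hi i) T = (∏ b ∈ T, if b = lo i then -p.s⁻¹ else 1)
      * sortCoeff p (lo i) T := by
    rw [sortCoeff, sortCoeff, ← Finset.prod_mul_distrib]
    refine Finset.prod_congr rfl fun b _ => ?_
    by_cases h1 : b = lo i
    · simp [h1, lo_lt_hi]
    · simp [lt_hi_iff, h1]
  rw [h, Finset.prod_ite_eq']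
  split_ifs <;> simp

/-- As `lo i` and `hi i` are adjacent, any `a ≠ hi i` lies above both or above neither, so the
exchange does not change how many elements are below `a`. -/
lemma sortCoeff_shift {i : Fin (n - 1)} {a : Fin n} (h : a ≠ hi i) {T : Finset (Fin n)}
    (h1 : lo i ∈ T) (h2 : hi i ∉ T) :
    sortCoeff p a (insert (hi i) (T.erase (lo i))) = sortCoeff p a T := by
  have h3 : hi i < a ↔ lo i < a := by
    simp only [lo, hi, Fin.lt_def, Fin.ext_iff, ne_eq] at *
    omega
  rw [sortCoeff, Finset.prod_insert (by simp [h2]), sortCoeff, ← Finset.mul_prod_erase T _ h1]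
  simp only [h3]

/-- Left multiplication by a vector. -/
def wedgeMul (n : ℕ) (p : Params) : V n →ₗ[ℂ] Ext n →ₗ[ℂ] Ext n :=
  LinearMap.mk₂ ℂ (fun x y T => ∑ a ∈ T, x a * (sortCoeff p a T * y (T.erase a)))
    (fun x x' y => by ext T; simp [add_mul, Finset.sum_add_distrib])
    (fun c x y => by ext T; simp [Finset.mul_sum, mul_assoc])
    (fun x y y' => by ext T; simp [mul_add, Finset.sum_add_distrib])
    (fun c x y => by
      ext T
      simp only [Pi.smul_apply, smul_eq_mul, Finset.mul_sum]
      exact Finset.sum_congr rfl fun a _ => by ring)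

lemma wedgeMul_v (a : Fin n) (y : Ext n) (T : Finset (Fin n)) :
    wedgeMul n p (v a) y T = if a ∈ T then sortCoeff p a T * y (T.erase a) else 0 := by
  simp [wedgeMul, v, Pi.single_apply]

lemma wedgeMul_self (a : Fin n) (y : Ext n) : wedgeMul n p (v a) (wedgeMul n p (v a) y) = 0 := by
  ext T
  simp [wedgeMul_v]

/-- Both terms are multiples of the value of `y` at `T` without `a` and `b`. In the second one `b`
still has `a` below it, which costs a factor `-s⁻¹` and cancels the coefficient `s`. -/
lemma wedgeMul_swap {a b : Fin n} (h : a < b) (y : Ext n) :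
    wedgeMul n p (v a) (wedgeMul n p (v b) y)
      + p.s • wedgeMul n p (v b) (wedgeMul n p (v a) y) = 0 := by
  ext T
  have hs := p.s_ne_zero
  by_cases ha : a ∈ T
  · by_cases hb : b ∈ T
    · simp only [Pi.add_apply, Pi.smul_apply, wedgeMul_v, ha, hb, Finset.mem_erase, h.ne, h.ne',
        ne_eq, not_false_eq_true, and_self, if_true, smul_eq_mul, Pi.zero_apply,
        sortCoeff_erase h.not_gt, sortCoeff_eq_of_mem h ha, Finset.erase_right_comm (a := b)]
      field_simp
      ring
    · simp [wedgeMul_v, ha, hb]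
  · simp [wedgeMul_v, ha]

/-! ### Operators of the generators on the model -/

/-- The operator of `eᵢ`. -/
def extE (i : Fin (n - 1)) : Ext n →ₗ[ℂ] Ext n where
  -- Elements of `Ext n` are coefficient functions: an operator that replaces `hi i` by `lo i` in
  -- basis vectors reads the coefficient at the inverse replacement.
  toFun y T := if lo i ∈ T ∧ hi i ∉ T then y (insert (hi i) (T.erase (lo i))) else 0
  map_add' x y := by ext T; simp only [Pi.add_apply]; split_ifs <;> simp
  map_smul' c y := by ext T; simp

/-- The operator of `fᵢ`. -/
def extF (i : Fin (n - 1)) : Ext n →ₗ[ℂ] Ext n where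
  toFun y T := if hi i ∈ T ∧ lo i ∉ T then y (insert (lo i) (T.erase (hi i))) else 0
  map_add' x y := by ext T; simp only [Pi.add_apply]; split_ifs <;> simp
  map_smul' c y := by ext T; simp

/-- The operator that acts on the basis vector of a subset by the product of the `d a`. -/
def extDiag (d : Fin n → ℂ) : Ext n →ₗ[ℂ] Ext n where
  toFun y T := (∏ a ∈ T, d a) * y T
  map_add' x y := by ext T; simp [mul_add]
  map_smul' c y := by ext T; simp; ring

lemma extE_apply (i : Fin (n - 1)) (y : Ext n) (T : Finset (Fin n)) : extE i y T =
    if lo i ∈ T ∧ hi i ∉ T then y (insert (hi i) (T.erase (lo i))) else 0 := rfl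

lemma extF_apply (i : Fin (n - 1)) (y : Ext n) (T : Finset (Fin n)) : extF i y T =
    if hi i ∈ T ∧ lo i ∉ T then y (insert (lo i) (T.erase (hi i))) else 0 := rfl

lemma extDiag_apply (d : Fin n → ℂ) (y : Ext n) (T : Finset (Fin n)) :
    extDiag d y T = (∏ a ∈ T, d a) * y T := rfl

lemma extDiag_wedgeMul (d : Fin n → ℂ) (a : Fin n) (y : Ext n) :
    extDiag d (wedgeMul n p (v a) y) = wedgeMul n p (d a • v a) (extDiag d y) := by
  ext T
  simp only [map_smul, LinearMap.smul_apply, Pi.smul_apply, extDiag_apply, wedgeMul_v, smul_eq_mul]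
  split_ifs with h
  · rw [← Finset.mul_prod_erase T d h]
    ring
  · simp

/-- The compatibility with `Δ(e) = e ⊗ 1 + ω ⊗ e` that carries the induction on the tensor degree.
Only `a = hi i` needs a computation. -/
lemma extE_wedgeMul (i : Fin (n - 1)) (a : Fin n) (y : Ext n) :
    extE i (wedgeMul n p (v a) y) = wedgeMul n p (natRep n p (U.of p.r p.s (.e i)) (v a)) y
      + wedgeMul n p (natRep n p (U.of p.r p.s (.w i)) (v a)) (extE i y) := by
  have hs := p.s_ne_zero
  have hlh := lo_lt_hi i
  ext T
  rw [natRep_e, natRep_w]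
  simp only [map_smul, LinearMap.smul_apply, Pi.add_apply, Pi.smul_apply, smul_eq_mul]
  rcases eq_or_ne a (hi i) with rfl | h1
  · simp only [if_true, hlh.ne', if_false, extE_apply, wedgeMul_v, Finset.mem_insert_self,
      Finset.mem_erase, ne_eq, not_true, false_and, not_false_eq_true, and_true, hlh.ne, true_and]
    by_cases hl : lo i ∈ T
    · by_cases hh : hi i ∈ T
      -- When `T` contains both indices the left side vanishes, and the two terms on the right
      -- cancel because `s * (-s⁻¹) = -1`.
      · have h2 : insert (hi i) ((T.erase (hi i)).erase (lo i)) = T.erase (lo i) := by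
          rw [Finset.erase_right_comm, Finset.insert_erase (by simp [hh, hlh.ne'])]
        simp only [hl, hh, h2, sortCoeff_hi, if_true, not_true, and_false, if_false]
        field_simp
        ring
      · simp only [hl, hh, if_true, not_false_eq_true, and_self, if_false, mul_zero, add_zero]
        rw [sortCoeff_insert (lt_irrefl _), sortCoeff_hi, if_neg (by simp),
          sortCoeff_erase (lt_irrefl _), Finset.erase_insert (by simp [hh])]
    · simp [hl]
  · rcases eq_or_ne a (lo i) with rfl | h2
    · simp [extE_apply, wedgeMul_v, hlh.ne]
    · simp only [h1, h2, if_false, map_zero, LinearMap.zero_apply, Pi.zero_apply, zero_add, one_mul,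
        extE_apply, wedgeMul_v, Finset.mem_insert, Finset.mem_erase, false_or, ne_eq,
        not_false_eq_true, true_and, h1.symm, h2.symm]
      by_cases h3 : lo i ∈ T ∧ hi i ∉ T
      · simp only [h3, not_false_eq_true, and_self, if_true, sortCoeff_shift h1 h3.1 h3.2,
          Finset.erase_right_comm (a := a), Finset.erase_insert_of_ne (Ne.symm h1)]
      · simp [h3]

lemma prod_diag (i : Fin (n - 1)) (x y : ℂ) (T : Finset (Fin n)) :
    (∏ a ∈ T, if a = lo i then x else if a = hi i then y else 1)
      = (if lo i ∈ T then x else 1) * (if hi i ∈ T then y else 1) := by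
  rw [← Finset.prod_ite_eq' T (lo i) fun _ => x, ← Finset.prod_ite_eq' T (hi i) fun _ => y,
    ← Finset.prod_mul_distrib]
  refine Finset.prod_congr rfl fun a _ => ?_
  by_cases h : a = lo i
  · simp [h, (lo_lt_hi i).ne]
  · simp [h]

/-- The counterpart for `Δ(f) = 1 ⊗ f + f ⊗ ω'`; the diagonal operator is that of `ω'ᵢ`, acting on
the tail. For `a = lo i` and both indices in `T`, its factor `s` at `lo i` produces the
cancellation. -/
lemma extF_wedgeMul (i : Fin (n - 1)) (a : Fin n) (y : Ext n) :
    extF i (wedgeMul n p (v a) y) = wedgeMul n p (v a) (extF i y)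
      + wedgeMul n p (natRep n p (U.of p.r p.s (.f i)) (v a))
        (extDiag (fun a => if a = lo i then p.s else if a = hi i then p.r else 1) y) := by
  have hs := p.s_ne_zero
  have hlh := lo_lt_hi i
  ext T
  rw [natRep_f]
  simp only [Pi.add_apply]
  rcases eq_or_ne a (lo i) with rfl | h1
  · simp only [if_true, extF_apply, wedgeMul_v, Finset.mem_insert_self, extDiag_apply, prod_diag,
      Finset.mem_erase, ne_eq, not_true, false_and, not_false_eq_true, and_true, hlh.ne, hlh.ne',
      true_and, if_false, mul_one]
    by_cases hh : hi i ∈ T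
    · by_cases hl : lo i ∈ T
      · have h2 : insert (lo i) ((T.erase (lo i)).erase (hi i)) = T.erase (hi i) := by
          rw [Finset.erase_right_comm, Finset.insert_erase (by simp [hl, hlh.ne])]
        simp only [hl, hh, h2, sortCoeff_hi, if_true, not_true, and_false, if_false]
        field_simp
        ring
      · simp only [hl, hh, if_true, not_false_eq_true, and_self, if_false, one_mul, zero_add]
        rw [sortCoeff_insert (lt_irrefl _), sortCoeff_hi, if_neg hl,
          sortCoeff_erase hlh.not_gt, Finset.erase_insert (by simp [hl])]
    · simp [hh]
  · simp only [h1, if_false, map_zero, LinearMap.zero_apply, Pi.zero_apply, add_zero]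
    rcases eq_or_ne a (hi i) with rfl | h2
    · simp [extF_apply, wedgeMul_v, hlh.ne']
    · simp only [extF_apply, wedgeMul_v, Finset.mem_insert, Finset.mem_erase, false_or, ne_eq,
        not_false_eq_true, true_and, h1, h2, h1.symm, h2.symm]
      by_cases h3 : hi i ∈ T ∧ lo i ∉ T
      · have h4 : hi i ∉ insert (lo i) (T.erase (hi i)) := by simp [hlh.ne']
        -- The exchange lemma is applied to the set obtained from `T` by putting `lo i` for `hi i`;
        -- exchanging back gives `T`.
        have h5 := sortCoeff_shift (p := p) h2 (Finset.mem_insert_self (lo i) (T.erase (hi i))) h4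
        rw [Finset.erase_insert (by simp [h3.2]), Finset.insert_erase h3.1] at h5
        simp only [h3, not_false_eq_true, and_self, if_true, ← h5,
          Finset.erase_right_comm (a := a), Finset.erase_insert_of_ne (Ne.symm h1)]
      · simp [h3]

end model

/-! ### The wedge spaces as subspaces of the model -/

section tensor

variable {n : ℕ} {p : Params}

/-- The map from `V^{⊗k}` to the model of the `(r,s)`-exterior algebra. -/
def powToExt (n : ℕ) (p : Params) : (k : ℕ) → (⨂[ℂ]^k (V n)) →ₗ[ℂ] Ext n
  | 0 => PiTensorProduct.lift (MultilinearMap.constOfIsEmpty ℂ _ (Pi.single ∅ 1))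
  | k + 1 => TensorProduct.lift ((wedgeMul n p).compl₂ (powToExt n p k)) ∘ₗ
      (consEquiv n k).symm.toLinearMap

lemma powToExt_cons {k : ℕ} (x : V n) (z : ⨂[ℂ]^k (V n)) :
    powToExt n p (k + 1) (consEquiv n k (x ⊗ₜ z)) = wedgeMul n p x (powToExt n p k z) := by
  simp [powToExt]

lemma powToExt_tprod_zero (m : Fin 0 → V n) :
    powToExt n p 0 (PiTensorProduct.tprod ℂ m) = Pi.single ∅ 1 := by
  simp [powToExt]

/-- Induction on `V^{⊗(k+1)} = V ⊗ V^{⊗k}`, with basis vectors on the left. -/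
lemma pow_induction {k : ℕ} {P : (⨂[ℂ]^(k + 1) (V n)) → Prop} (h0 : P 0)
    (h : ∀ a z, P (consEquiv n k (v a ⊗ₜ z))) (hadd : ∀ x y, P x → P y → P (x + y))
    (z : ⨂[ℂ]^(k + 1) (V n)) : P z := by
  obtain ⟨τ, rfl⟩ := (consEquiv n k).surjective z
  induction τ with
  | zero => simpa using h0
  | add a b iha ihb => rw [map_add]; exact hadd _ _ iha ihb
  | tmul x z =>
    have hx : x = ∑ a, x a • v a := by
      ext b
      simp [v, Pi.single_apply]
    rw [hx, TensorProduct.sum_tmul, map_sum]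
    refine Finset.sum_induction _ P hadd ?_ fun a _ => ?_
    · simpa using h0
    · rw [TensorProduct.smul_tmul]
      exact h _ _

/-- A group-like generator that is diagonal on `V` multiplies a product of basis vectors by the
product of its eigenvalues; this handles `ωᵢ` and `ω'ᵢ` together. -/
lemma powToExt_diag {k : ℕ} (g : Gen n) (d : Fin n → ℂ)
    (hd : ∀ a, natRep n p (U.of p.r p.s g) (v a) = d a • v a)
    (h0 : counit n p.r p.s (U.of p.r p.s g) = 1)
    (hg : coprodGen p.r p.s g = U.of p.r p.s g ⊗ₜ U.of p.r p.s g) (z : ⨂[ℂ]^k (V n)) :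
    powToExt n p k (powRep n p k (U.of p.r p.s g) z) = extDiag d (powToExt n p k z) := by
  induction k with
  | zero =>
    induction z using PiTensorProduct.induction_on with
    | smul_tprod c m =>
      have h : extDiag d (Pi.single ∅ 1) = Pi.single ∅ 1 := by
        ext T
        by_cases hT : T = ∅ <;> simp [extDiag_apply, hT]
      simp [powRep, h0, powToExt_tprod_zero, h]
    | add x y hx hy => rw [map_add, map_add, hx, hy, map_add, map_add]
  | succ k ih =>
    induction z using pow_induction with
    | h0 => simp
    | hadd x y hx hy => rw [map_add, map_add, hx, hy, map_add, map_add]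
    | h a z =>
      rw [powRep_cons, tensorRep_of, hg, Algebra.TensorProduct.map_tmul, endTensor_tmul,
        powToExt_cons, ih, hd, powToExt_cons, extDiag_wedgeMul]

lemma counit_of (g : Gen n) : counit n p.r p.s (U.of p.r p.s g) = counitGen g :=
  U.lift_of _ _ _

lemma powToExt_w {k : ℕ} (i : Fin (n - 1)) (z : ⨂[ℂ]^k (V n)) :
    powToExt n p k (powRep n p k (U.of p.r p.s (.w i)) z)
      = extDiag (fun a => if a = lo i then p.r else if a = hi i then p.s else 1)
        (powToExt n p k z) :=
  powToExt_diag _ _ (natRep_w i) (counit_of _) rfl z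

lemma powToExt_w' {k : ℕ} (i : Fin (n - 1)) (z : ⨂[ℂ]^k (V n)) :
    powToExt n p k (powRep n p k (U.of p.r p.s (.w' i)) z)
      = extDiag (fun a => if a = lo i then p.s else if a = hi i then p.r else 1)
        (powToExt n p k z) :=
  powToExt_diag _ _ (natRep_w' i) (counit_of _) rfl z

lemma powToExt_zero_apply (z : ⨂[ℂ]^0 (V n)) {T : Finset (Fin n)} (hT : T ≠ ∅) :
    powToExt n p 0 z T = 0 := by
  induction z using PiTensorProduct.induction_on with
  | smul_tprod c m => simp [powToExt_tprod_zero, hT]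
  | add x y hx hy => rw [map_add, Pi.add_apply, hx, hy, add_zero]

lemma powToExt_e {k : ℕ} (i : Fin (n - 1)) (z : ⨂[ℂ]^k (V n)) :
    powToExt n p k (powRep n p k (U.of p.r p.s (.e i)) z) = extE i (powToExt n p k z) := by
  induction k with
  | zero =>
    ext T
    -- In degree zero `eᵢ` acts through the counit, hence by zero, and the image in the model is
    -- supported on the empty set, which no insertion produces.
    rw [extE_apply, powToExt_zero_apply z (Finset.insert_ne_empty _ _)]
    simp [powRep, counit_of, counitGen]
  | succ k ih =>
    induction z using pow_induction with
    | h0 => simp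
    | hadd x y hx hy => rw [map_add, map_add, hx, hy, map_add, map_add]
    | h a z =>
      rw [powRep_cons, tensorRep_e, map_add, map_add, powToExt_cons, powToExt_cons, powToExt_cons,
        ih, extE_wedgeMul]

lemma powToExt_f {k : ℕ} (i : Fin (n - 1)) (z : ⨂[ℂ]^k (V n)) :
    powToExt n p k (powRep n p k (U.of p.r p.s (.f i)) z) = extF i (powToExt n p k z) := by
  induction k with
  | zero =>
    ext T
    rw [extF_apply, powToExt_zero_apply z (Finset.insert_ne_empty _ _)]
    simp [powRep, counit_of, counitGen]
  | succ k ih =>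
    induction z using pow_induction with
    | h0 => simp
    | hadd x y hx hy => rw [map_add, map_add, hx, hy, map_add, map_add]
    | h a z =>
      rw [powRep_cons, tensorRep_f, map_add, map_add, powToExt_cons, powToExt_cons, powToExt_cons,
        ih, extF_wedgeMul, powToExt_w']

lemma powToExt_consTwo {k : ℕ} {t : V n ⊗[ℂ] V n} (ht : t ∈ symSq n p) (z : ⨂[ℂ]^k (V n)) :
    powToExt n p (k + 2) (consTwo n k (t ⊗ₜ z)) = 0 := by
  revert t
  change symSq n p ≤ LinearMap.ker (powToExt n p (k + 2) ∘ₗ consTwo n k ∘ₗ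
    (TensorProduct.mk ℂ (V n ⊗[ℂ] V n) (⨂[ℂ]^k (V n))).flip z)
  refine Submodule.span_le.2 ?_
  rintro _ (⟨i, rfl⟩ | ⟨i, j, hij, rfl⟩)
  · simp [consTwo_tmul, powToExt_cons, wedgeMul_self]
  · simp [consTwo_tmul, powToExt_cons,
      wedgeMul_swap hij]

lemma symSum_le_ker (k : ℕ) : symSum n p k ≤ LinearMap.ker (powToExt n p k) := by
  induction k with
  | zero => exact symSum_le fun i hi => absurd hi (by omega)
  | succ k ih =>
    refine symSum_le fun i hi m t ht => ?_
    rw [← Fin.cons_self_tail m, LinearMap.mem_ker]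
    cases i with
    | succ i =>
      have h := ih (insertPair_mem (p := p) i (by omega) (Fin.tail m) ht)
      rw [insertPair_succ i (by omega), powToExt_cons, LinearMap.mem_ker.1 h, map_zero]
    | zero =>
      obtain ⟨k, rfl⟩ : ∃ k', k = k' + 1 := ⟨k - 1, by omega⟩
      rw [← Fin.cons_self_tail (Fin.tail m), insertPair_zero, powToExt_consTwo ht]

/-! ### Straightening: increasing basis tensors form a basis modulo the symmetric relations -/

/-- The tensor of basis vectors with the given indices. -/
def basisTensor {k : ℕ} (a : Fin k → Fin n) : ⨂[ℂ]^k (V n) :=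
  PiTensorProduct.tprod ℂ fun i => v (a i)

lemma basisTensor_cons {k : ℕ} (b : Fin n) (a : Fin k → Fin n) :
    basisTensor (Fin.cons b a : Fin (k + 1) → Fin n) = consEquiv n k (v b ⊗ₜ basisTensor a) := by
  rw [basisTensor, basisTensor, consEquiv_tmul]
  congr 1
  funext i
  refine Fin.cases ?_ (fun i => ?_) i <;> simp

/-- The tensors that are, up to `symSum`, combinations of strictly increasing basis tensors
with indices at least `m`. -/
def sortable (n : ℕ) (p : Params) (k m : ℕ) : Submodule ℂ (⨂[ℂ]^k (V n)) :=
  Submodule.span ℂ {z | ∃ a : Fin k → Fin n, StrictMono a ∧ (∀ i, m ≤ (a i).val) ∧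
    z = basisTensor a} ⊔ symSum n p k

lemma basisTensor_mem_sortable {k m : ℕ} {a : Fin k → Fin n} (ha : StrictMono a)
    (hm : ∀ i, m ≤ (a i).val) : basisTensor a ∈ sortable n p k m :=
  Submodule.mem_sup_left (Submodule.subset_span ⟨a, ha, hm, rfl⟩)

lemma sortable_induction {k m : ℕ} {N : Submodule ℂ (⨂[ℂ]^(k + 1) (V n))} (b : Fin n)
    (h : ∀ a : Fin k → Fin n, StrictMono a → (∀ i, m ≤ (a i).val) →
      consEquiv n k (v b ⊗ₜ basisTensor a) ∈ N) (hN : symSum n p (k + 1) ≤ N)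
    {z : ⨂[ℂ]^k (V n)} (hz : z ∈ sortable n p k m) : consEquiv n k (v b ⊗ₜ z) ∈ N := by
  have hle : sortable n p k m ≤
      N.comap ((consEquiv n k).toLinearMap ∘ₗ TensorProduct.mk ℂ (V n) _ (v b)) := by
    refine sup_le (Submodule.span_le.2 ?_) fun z hz => hN (cons_mem _ hz)
    rintro _ ⟨a, ha, hm, rfl⟩
    exact h a ha hm
  exact hle hz

/-- Insertion sort: `v b` is moved to the right past the smaller vectors by the quadratic relations.
The lower bound `m` records that everything behind a vector already passed remains larger than it,
so that the final tensor is strictly increasing. -/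
lemma cons_basisTensor_mem_sortable {k m : ℕ} {b : Fin n} (hb : m ≤ b.val) {a : Fin k → Fin n}
    (ha : StrictMono a) (hm : ∀ i, m ≤ (a i).val) :
    consEquiv n k (v b ⊗ₜ basisTensor a) ∈ sortable n p (k + 1) m := by
  induction k generalizing m with
  | zero =>
    rw [← basisTensor_cons]
    refine basisTensor_mem_sortable (Fin.strictMono_cons.2 ⟨fun i => i.elim0, ha⟩) fun i => ?_
    rw [Fin.fin_one_eq_zero i]
    exact hb
  | succ k ih =>
    obtain ⟨c, a, rfl⟩ : ∃ c a', a = Fin.cons c a' := ⟨_, _, (Fin.cons_self_tail a).symm⟩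
    obtain ⟨hc, ha'⟩ := Fin.strictMono_cons.1 ha
    have hmc : m ≤ c.val := by simpa using hm 0
    rcases lt_trichotomy b c with hbc | rfl | hbc
    · rw [← basisTensor_cons]
      refine basisTensor_mem_sortable (Fin.strictMono_cons.2 ⟨fun i => ?_, ha⟩) fun i => ?_
      · refine Fin.cases hbc (fun i => ?_) i
        exact hbc.trans (hc i)
      · exact Fin.cases hb hm i
    · rw [basisTensor_cons, ← consTwo_tmul]
      exact Submodule.mem_sup_right (consTwo_mem (Submodule.subset_span (Or.inl ⟨b, rfl⟩)) _)
    · have h1 : consTwo n k ((v c ⊗ₜ v b + p.s • (v b ⊗ₜ v c)) ⊗ₜ basisTensor a)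
          ∈ sortable n p (k + 2) m := Submodule.mem_sup_right
        (consTwo_mem (Submodule.subset_span (Or.inr ⟨c, b, hbc, rfl⟩)) _)
      -- Here `c < b`. Inserting `b` into the tail with lower bound `c + 1` leaves indices greater
      -- than `c`, so `v c` may be put back in front.
      have h2 : consEquiv n (k + 1) (v c ⊗ₜ consEquiv n k (v b ⊗ₜ basisTensor a))
          ∈ sortable n p (k + 2) m := by
        refine sortable_induction (m := c.val + 1) c (fun d hd hdm => ?_) le_sup_right
          (ih hbc ha' fun i => hc i)
        rw [← basisTensor_cons]
        refine basisTensor_mem_sortable (Fin.strictMono_cons.2 ⟨hdm, hd⟩) fun i => ?_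
        refine Fin.cases hmc (fun i => ?_) i
        have := hdm i
        simp only [Fin.cons_succ]
        omega
      rw [TensorProduct.add_tmul, map_add, consTwo_tmul, ← TensorProduct.smul_tmul', map_smul,
        consTwo_tmul, ← basisTensor_cons c] at h1
      -- The relation `h1` is the sum of the sorted term `h2` and `s` times the tensor in question,
      -- and `s` is invertible.
      exact (Submodule.smul_mem_iff _ p.s_ne_zero).1 ((Submodule.add_mem_iff_right _ h2).1 h1)

lemma mem_sortable (k : ℕ) (z : ⨂[ℂ]^k (V n)) : z ∈ sortable n p k 0 := by
  induction k with
  | zero =>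
    induction z using PiTensorProduct.induction_on with
    | smul_tprod c m =>
      refine Submodule.smul_mem _ _ ?_
      rw [Subsingleton.elim m fun i => v (i.elim0 : Fin n)]
      exact basisTensor_mem_sortable (a := fun i => i.elim0) (fun i => i.elim0) (fun i => i.elim0)
    | add x y hx hy => exact add_mem hx hy
  | succ k ih =>
    induction z using pow_induction with
    | h0 => exact Submodule.zero_mem _
    | hadd x y hx hy => exact add_mem hx hy
    | h b z =>
      exact sortable_induction b (fun a ha hm => cons_basisTensor_mem_sortable b.val.zero_le ha hm)
        le_sup_right (ih z)

/-- Each new leftmost index is below all those already present, so no sorting factor appears. -/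
lemma powToExt_basisTensor {k : ℕ} {a : Fin k → Fin n} (ha : StrictMono a) :
    powToExt n p k (basisTensor a) = Pi.single (Finset.univ.image a) 1 := by
  induction k with
  | zero => rw [basisTensor, powToExt_tprod_zero]; congr
  | succ k ih =>
    obtain ⟨c, a, rfl⟩ : ∃ c a', a = Fin.cons c a' := ⟨_, _, (Fin.cons_self_tail a).symm⟩
    obtain ⟨hc, ha'⟩ := Fin.strictMono_cons.1 ha
    rw [basisTensor_cons, powToExt_cons, ih ha']
    have h1 : Finset.univ.image (Fin.cons c a : Fin (k + 1) → Fin n)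
        = insert c (Finset.univ.image a) := by
      ext x
      simp [Fin.exists_fin_succ, eq_comm]
    have h2 : c ∉ Finset.univ.image a := by
      simpa using fun i => (hc i).ne'
    rw [h1]
    ext T
    rw [wedgeMul_v]
    by_cases h3 : T = insert c (Finset.univ.image a)
    · rw [h3, Finset.erase_insert h2, sortCoeff_insert (lt_irrefl _), sortCoeff,
        Finset.prod_eq_one fun b hb => ?_]
      · simp
      · obtain ⟨i, -, rfl⟩ := Finset.mem_image.1 hb
        rw [if_neg (hc i).not_gt]
    · rw [Pi.single_eq_of_ne h3]
      split_ifs with h4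
      · rw [Pi.single_eq_of_ne, mul_zero]
        rintro h5
        exact h3 (by rw [← h5, Finset.insert_erase h4])
      · rfl

/-- A kernel element is, modulo `symSum`, a combination of increasing basis tensors. These have
linearly independent images, so all its coefficients vanish. -/
lemma ker_powToExt (k : ℕ) : LinearMap.ker (powToExt n p k) = symSum n p k := by
  refine le_antisymm (fun z hz => ?_) (symSum_le_ker k)
  obtain ⟨x, hx, y, hy, rfl⟩ := Submodule.mem_sup.1 (mem_sortable (p := p) k z)
  have hrange : {z | ∃ a : Fin k → Fin n, StrictMono a ∧ (∀ i, 0 ≤ (a i).val) ∧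
      z = basisTensor a} = Set.range fun a : {a : Fin k → Fin n // StrictMono a} =>
        basisTensor a.1 := by
    ext z
    constructor
    · rintro ⟨a, ha, -, rfl⟩
      exact ⟨⟨a, ha⟩, rfl⟩
    · rintro ⟨a, rfl⟩
      exact ⟨a.1, a.2, fun _ => Nat.zero_le _, rfl⟩
  rw [hrange] at hx
  obtain ⟨c, rfl⟩ := (Finsupp.mem_span_range_iff_exists_finsupp).1 hx
  -- A strictly increasing tuple is determined by its set of values.
  have hinj : Function.Injective fun a : {a : Fin k → Fin n // StrictMono a} =>
      Finset.univ.image a.1 := fun a b h => by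
    have h' := congrArg (fun s : Finset (Fin n) => (s : Set (Fin n))) h
    simp only [Finset.coe_image, Finset.coe_univ, Set.image_univ] at h'
    exact Subtype.ext ((a.2.range_inj b.2).1 h')
  have hc : c = 0 := by
    have hli := (Pi.linearIndependent_single_one (Finset (Fin n)) ℂ).comp _ hinj
    refine linearIndependent_iff.1 hli c ?_
    rw [LinearMap.mem_ker, map_add, LinearMap.mem_ker.1 (symSum_le_ker k hy), add_zero,
      Finsupp.sum, map_sum] at hz
    rw [Finsupp.linearCombination_apply, Finsupp.sum, ← hz]
    refine Finset.sum_congr rfl fun a _ => ?_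
    rw [map_smul, powToExt_basisTensor a.2]
    rfl
  simpa [hc] using hy

lemma powToExt_apply_of_card_ne {k : ℕ} (z : ⨂[ℂ]^k (V n)) {T : Finset (Fin n)}
    (hT : T.card ≠ k) : powToExt n p k z T = 0 := by
  induction k generalizing T with
  | zero => exact powToExt_zero_apply z (by simpa using hT)
  | succ k ih =>
    induction z using pow_induction with
    | h0 => simp
    | hadd x y hx hy => rw [map_add, Pi.add_apply, hx, hy, add_zero]
    | h a z =>
      rw [powToExt_cons, wedgeMul_v]
      split_ifs with h
      · rw [ih, mul_zero]
        have := Finset.card_erase_add_one h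
        omega
      · rfl

end tensor

/-! ### Simplicity of the wedge modules -/

section simplicity

variable {n : ℕ} {p : Params}

/-- The subset of the first `k` indices. -/
def topSet (n k : ℕ) : Finset (Fin n) := {a | a.val < k}

/-- The sum of the indices in a subset. -/
def height (T : Finset (Fin n)) : ℕ := ∑ a ∈ T, a.val

lemma card_insert_erase {a b : Fin n} {T : Finset (Fin n)} (ha : a ∈ T) (hb : b ∉ T) :
    (insert b (T.erase a)).card = T.card := by
  rw [Finset.card_insert_of_notMem (by simp [hb]), Finset.card_erase_add_one ha]

lemma height_shift {i : Fin (n - 1)} {T : Finset (Fin n)} (h : lo i ∈ T) (h' : hi i ∉ T) :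
    height (insert (hi i) (T.erase (lo i))) = height T + 1 := by
  rw [height, Finset.sum_insert (by simp [h']), height, ← Finset.add_sum_erase T _ h]
  simp only [lo, hi]
  omega

lemma insert_erase_cancel {a b : Fin n} {T : Finset (Fin n)} (ha : a ∈ T) (hb : b ∉ T) :
    insert a ((insert b (T.erase a)).erase b) = T := by
  rw [Finset.erase_insert (by simp [hb]), Finset.insert_erase ha]

/-- This closure is why every `eᵢ` kills the top vector and why no `fᵢ` has the top vector in its
image. -/
lemma topSet_closed {k : ℕ} {i : Fin (n - 1)} (h : hi i ∈ topSet n k) : lo i ∈ topSet n k := by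
  simp only [topSet, hi, lo, Finset.mem_filter, Finset.mem_univ, true_and] at *
  omega

/-- Without such an `i` the set would be closed downwards, hence an initial segment. This gives the
move that brings a subset closer to the initial one. -/
lemma exists_shift {T : Finset (Fin n)} (hT : T ≠ topSet n T.card) :
    ∃ i : Fin (n - 1), hi i ∈ T ∧ lo i ∉ T := by
  by_contra! h
  have h1 (d : ℕ) (a b : Fin n) (hab : a.val = b.val + d) (ha : a ∈ T) : b ∈ T := by
    induction d generalizing a with
    | zero => rwa [← Fin.ext hab]
    | succ d ih =>
      have h2 := a.isLt
      refine ih (lo ⟨b.val + d, by omega⟩) rfl (h ⟨b.val + d, by omega⟩ ?_)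
      convert ha using 1
      exact Fin.ext hab.symm
  refine hT (Finset.eq_of_subset_of_card_le (fun a ha => ?_) ?_)
  -- All `a + 1` indices up to `a` lie in `T`, so `a < T.card`.
  · have h2 : Finset.Iic a ⊆ T := fun b hb =>
      h1 (a.val - b.val) a b (by have := Fin.le_def.1 (Finset.mem_Iic.1 hb); omega) ha
    have h3 := Finset.card_le_card h2
    rw [Fin.card_Iic] at h3
    simpa [topSet] using h3
  · simp [topSet, Fin.card_filter_val_lt]

lemma extF_single {i : Fin (n - 1)} {T : Finset (Fin n)} (h : hi i ∈ T) (h' : lo i ∉ T) :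
    extF i (Pi.single (insert (lo i) (T.erase (hi i))) 1) = Pi.single T 1 := by
  ext S
  rw [extF_apply]
  by_cases hS : S = T
  · subst hS
    simp [h, h']
  · rw [Pi.single_eq_of_ne hS]
    refine ite_eq_right_iff.2 fun hi => Pi.single_eq_of_ne (fun he => hS ?_) _
    have h1 := insert_erase_cancel hi.1 hi.2
    rwa [he, insert_erase_cancel h h', eq_comm] at h1

/-- A nonzero space that is stable under the operators of the `eᵢ` contains the basis vector
of highest weight. -/
lemma single_topSet_mem {k : ℕ} {N : Submodule ℂ (Ext n)}
    (hcard : ∀ y ∈ N, ∀ T : Finset (Fin n), T.card ≠ k → y T = 0)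
    (hE : ∀ i, ∀ y ∈ N, extE i y ∈ N) (hN : N ≠ ⊥) : Pi.single (topSet n k) 1 ∈ N := by
  -- Induction on a strict bound `d` for the heights in the support of `y`: a nonzero `eᵢ y` has
  -- heights one smaller.
  have key (d : ℕ) (y : Ext n) (hy : y ∈ N) (hy0 : y ≠ 0)
      (hd : ∀ T, d ≤ height T → y T = 0) : Pi.single (topSet n k) 1 ∈ N := by
    induction d generalizing y with
    | zero => exact absurd (funext fun T => hd T (Nat.zero_le _)) hy0
    | succ d ih =>
      by_cases h : ∀ i, extE i y = 0
      -- A vector killed by all `eᵢ` is a multiple of the top one: at any other `k`-subset its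
      -- coefficient reappears as a coefficient of some `eᵢ y`.
      · have h1 (T : Finset (Fin n)) (hT : T ≠ topSet n k) : y T = 0 := by
          by_contra h2
          have h3 : T.card = k := by
            by_contra h3
            exact h2 (hcard y hy T h3)
          obtain ⟨i, hi1, hi2⟩ := exists_shift (h3.symm ▸ hT)
          have h4 := congrFun (h i) (insert (lo i) (T.erase (hi i)))
          rw [extE_apply, if_pos ⟨by simp, by simp [(lo_lt_hi i).ne']⟩,
            insert_erase_cancel hi1 hi2] at h4
          exact h2 h4
        have h2 : y = y (topSet n k) • Pi.single (topSet n k) 1 := by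
          ext T
          by_cases hT : T = topSet n k
          · simp [hT]
          · simp [hT, h1 T hT]
        have h3 : y (topSet n k) ≠ 0 := fun h3 => hy0 (by rw [h2, h3, zero_smul])
        rw [h2] at hy
        exact (Submodule.smul_mem_iff _ h3).1 hy
      · push Not at h
        obtain ⟨i, hi⟩ := h
        refine ih _ (hE i y hy) hi fun T hT => ?_
        rw [extE_apply]
        refine ite_eq_right_iff.2 fun h => hd _ ?_
        rw [height_shift h.1 h.2]
        omega
  obtain ⟨y, hy, hy0⟩ := N.ne_bot_iff.1 hN
  refine key ((Finset.univ : Finset (Finset (Fin n))).sup height + 1) y hy hy0 fun T hT => ?_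
  have := Finset.le_sup (f := height) (Finset.mem_univ T)
  omega

/-- By induction on the height, the basis vector of a non-initial subset is the image under some
`fᵢ` of the one of height one less. -/
lemma single_mem {k : ℕ} {N : Submodule ℂ (Ext n)} (hF : ∀ i, ∀ y ∈ N, extF i y ∈ N)
    (htop : Pi.single (topSet n k) 1 ∈ N) {T : Finset (Fin n)} (hT : T.card = k) :
    Pi.single T 1 ∈ N := by
  induction hd : height T generalizing T with
  | zero =>
    by_cases h : T = topSet n k
    · rwa [h]
    · obtain ⟨i, h1, h2⟩ := exists_shift (hT.symm ▸ h)
      have h3 := (Finset.sum_eq_zero_iff.1 hd) _ h1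
      simp [hi] at h3
  | succ d ih =>
    by_cases h : T = topSet n k
    · rwa [h]
    · obtain ⟨i, h1, h2⟩ := exists_shift (hT.symm ▸ h)
      rw [← extF_single h1 h2]
      refine hF i _ (ih ((card_insert_erase h1 h2).trans hT) ?_)
      have h3 := height_shift (i := i) (T := insert (lo i) (T.erase (hi i))) (by simp)
        (by simp [(lo_lt_hi i).ne'])
      rw [insert_erase_cancel h1 h2] at h3
      omega

/-! ### Transfer from the model to the module `V^{⊗k}` -/

/-- The map `powToExt` on the `U_{r,s}(sl_n)`-module `V^{⊗k}`. -/
def tpowToExt (n : ℕ) (p : Params) (k : ℕ) : TPow n p k →+ Ext n :=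
  (powToExt n p k).toAddMonoidHom

lemma mem_symSubmodule {k : ℕ} {z : TPow n p k} :
    z ∈ symSubmodule n p k ↔ tpowToExt n p k z = 0 := by
  change _ ↔ _ ∈ LinearMap.ker (powToExt n p k)
  rw [ker_powToExt]
  rfl

lemma tpowToExt_algebraMap_smul {k : ℕ} (c : ℂ) (z : TPow n p k) :
    tpowToExt n p k (algebraMap ℂ (U n p.r p.s) c • z) = c • tpowToExt n p k z := by
  change powToExt n p k (powRep n p k (algebraMap ℂ (U n p.r p.s) c) z) = _
  rw [AlgHom.commutes]
  exact map_smul (powToExt n p k) c _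

lemma tpowToExt_e {k : ℕ} (i : Fin (n - 1)) (z : TPow n p k) :
    tpowToExt n p k (U.of p.r p.s (.e i) • z) = extE i (tpowToExt n p k z) :=
  powToExt_e i _

lemma tpowToExt_f {k : ℕ} (i : Fin (n - 1)) (z : TPow n p k) :
    tpowToExt n p k (U.of p.r p.s (.f i) • z) = extF i (tpowToExt n p k z) :=
  powToExt_f i _

lemma tpowToExt_w {k : ℕ} (i : Fin (n - 1)) (z : TPow n p k) :
    tpowToExt n p k (U.of p.r p.s (.w i) • z)
      = extDiag (fun a => if a = lo i then p.r else if a = hi i then p.s else 1)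
        (tpowToExt n p k z) :=
  powToExt_w i _

lemma tpowToExt_w' {k : ℕ} (i : Fin (n - 1)) (z : TPow n p k) :
    tpowToExt n p k (U.of p.r p.s (.w' i) • z)
      = extDiag (fun a => if a = lo i then p.s else if a = hi i then p.r else 1)
        (tpowToExt n p k z) :=
  powToExt_w' i _

lemma tpowToExt_apply_of_card_ne {k : ℕ} (z : TPow n p k) {T : Finset (Fin n)}
    (hT : T.card ≠ k) : tpowToExt n p k z T = 0 :=
  powToExt_apply_of_card_ne _ hT

lemma tpowToExt_pureTensor_top {k : ℕ} (hk : k ≤ n) :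
    tpowToExt n p k (pureTensor p fun j : Fin k => v (Fin.castLE hk j))
      = Pi.single (topSet n k) 1 := by
  have h := powToExt_basisTensor (p := p) (Fin.strictMono_castLE hk)
  have h1 : Finset.univ.image (Fin.castLE hk) = topSet n k := by
    ext a
    simp only [topSet, Finset.mem_image, Finset.mem_univ, true_and, Finset.mem_filter]
    exact ⟨fun ⟨j, hj⟩ => hj ▸ j.isLt, fun ha => ⟨⟨a.val, ha⟩, rfl⟩⟩
  rwa [h1] at h

/-- The image of a submodule of `V^{⊗k}` in the model. -/
def extImage {k : ℕ} (N : Submodule (U n p.r p.s) (TPow n p k)) : Submodule ℂ (Ext n) where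
  carrier := {y | ∃ z ∈ N, tpowToExt n p k z = y}
  zero_mem' := ⟨0, N.zero_mem, map_zero _⟩
  add_mem' := by
    rintro _ _ ⟨x, hx, rfl⟩ ⟨y, hy, rfl⟩
    exact ⟨x + y, N.add_mem hx hy, map_add _ _ _⟩
  smul_mem' := by
    rintro c _ ⟨x, hx, rfl⟩
    refine ⟨algebraMap ℂ _ c • x, N.smul_mem _ hx, ?_⟩
    rw [tpowToExt_algebraMap_smul]

/-- A strictly larger submodule has a nonzero image in the model, stable under the `eᵢ` and `fᵢ`.
That image contains the top vector, hence every basis vector of degree `k`; as the submodule also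
contains the kernel, it is everything. -/
lemma isCoatom_symSubmodule {k : ℕ} (hk : k ≤ n) : IsCoatom (symSubmodule n p k) := by
  constructor
  · intro h
    have h1 : (pureTensor p fun j : Fin k => v (Fin.castLE hk j)) ∈ symSubmodule n p k :=
      h ▸ Submodule.mem_top
    rw [mem_symSubmodule, tpowToExt_pureTensor_top] at h1
    exact one_ne_zero ((Pi.single_eq_zero_iff).1 h1)
  · intro N hN
    have hcard : ∀ y ∈ extImage N, ∀ T : Finset (Fin n), T.card ≠ k → y T = 0 := by
      rintro _ ⟨z, -, rfl⟩ T hT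
      exact tpowToExt_apply_of_card_ne _ hT
    have hE : ∀ i, ∀ y ∈ extImage N, extE i y ∈ extImage N := by
      rintro i _ ⟨z, hz, rfl⟩
      exact ⟨_, N.smul_mem _ hz, tpowToExt_e i _⟩
    have hF : ∀ i, ∀ y ∈ extImage N, extF i y ∈ extImage N := by
      rintro i _ ⟨z, hz, rfl⟩
      exact ⟨_, N.smul_mem _ hz, tpowToExt_f i _⟩
    have hne : extImage N ≠ ⊥ := by
      obtain ⟨z, hz, hz'⟩ := Set.exists_of_ssubset hN
      refine (Submodule.ne_bot_iff _).2 ⟨_, ⟨z, hz, rfl⟩, fun h => hz' (mem_symSubmodule.2 h)⟩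
    have htop := single_topSet_mem hcard hE hne
    refine eq_top_iff.2 fun z _ => ?_
    have hz : tpowToExt n p k z ∈ extImage N := by
      rw [← Finset.univ_sum_single (tpowToExt n p k z)]
      refine Submodule.sum_mem _ fun T _ => ?_
      by_cases hT : T.card = k
      · have h := Submodule.smul_mem _ (tpowToExt n p k z T) (single_mem hF htop hT)
        rwa [← Pi.single_smul, smul_eq_mul, mul_one] at h
      · rw [tpowToExt_apply_of_card_ne _ hT, Pi.single_zero]
        exact Submodule.zero_mem _
    obtain ⟨x, hx, hxz⟩ := hz
    have h : z - x ∈ symSubmodule n p k :=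
      mem_symSubmodule.2 ((map_sub _ _ _).trans (sub_eq_zero.2 hxz.symm))
    exact (Submodule.sub_mem_iff_left N hx).1 (hN.le h)

lemma isSimpleModule_wedge {k : ℕ} (hk : k ≤ n) : IsSimpleModule (U n p.r p.s) (Wedge n p k) :=
  isSimpleModule_iff_isCoatom.2 (isCoatom_symSubmodule hk)

/-! ### The highest weight vector of the wedge module -/

lemma eps_dotProduct (a : Fin n) (μ : Fin n → ℤ) : eps a ⬝ᵥ μ = μ a := by
  simp [eps]

lemma fundWeight_apply {k : ℕ} (a : Fin n) :
    fundWeight n k a = if a ∈ topSet n k then 1 else 0 := by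
  simp [fundWeight, eps, topSet, Pi.single_apply, Finset.sum_apply]

lemma extDiag_single_topSet {k : ℕ} (x y : ℂ) (i : Fin (n - 1)) :
    extDiag (fun a => if a = lo i then x else if a = hi i then y else 1)
      (Pi.single (topSet n k) 1) =
    (x ^ fundWeight n k (lo i) * y ^ fundWeight n k (hi i)) • Pi.single (topSet n k) 1 := by
  ext T
  rw [extDiag_apply, Pi.smul_apply, smul_eq_mul]
  by_cases hT : T = topSet n k
  · rw [hT, prod_diag, fundWeight_apply, fundWeight_apply]
    split_ifs <;> simp
  · simp [hT]

lemma extE_single_topSet {k : ℕ} (i : Fin (n - 1)) :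
    extE i (Pi.single (topSet n k) 1) = 0 := by
  ext T
  rw [extE_apply]
  refine ite_eq_right_iff.2 fun h => Pi.single_eq_of_ne (fun he => ?_) _
  have h1 := topSet_closed (he ▸ Finset.mem_insert_self (hi i) _)
  rw [← he] at h1
  simp [(lo_lt_hi i).ne] at h1

lemma smul_wedgeTop_eq {k : ℕ} (hk : k ≤ n) (u : U n p.r p.s) (c : ℂ)
    (h : tpowToExt n p k (u • pureTensor p fun j : Fin k => v (Fin.castLE hk j))
      = c • Pi.single (topSet n k) 1) :
    u • (wedgeTop p hk : Wedge n p k) = algebraMap ℂ (U n p.r p.s) c • wedgeTop p hk := by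
  rw [wedgeTop, ← map_smul, ← map_smul, ← sub_eq_zero, ← map_sub, ← LinearMap.mem_ker,
    Submodule.ker_mkQ, mem_symSubmodule]
  refine (map_sub _ _ _).trans (sub_eq_zero.2 (h.trans ?_))
  rw [tpowToExt_algebraMap_smul, tpowToExt_pureTensor_top]

lemma wedgeTop_ne_zero {k : ℕ} (hk : k ≤ n) : (wedgeTop p hk : Wedge n p k) ≠ 0 := by
  rw [wedgeTop, Ne, ← LinearMap.mem_ker, Submodule.ker_mkQ, mem_symSubmodule,
    tpowToExt_pureTensor_top]
  exact fun h => one_ne_zero ((Pi.single_eq_zero_iff).1 h)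

lemma isHighestWeightVector_wedgeTop {k : ℕ} (hk : k ≤ n) :
    IsHighestWeightVector (r := p.r) (s := p.s) (fundWeight n k)
      (wedgeTop p hk : Wedge n p k) := by
  refine ⟨wedgeTop_ne_zero hk, fun i => ⟨?_, smul_wedgeTop_eq hk _ _ ?_,
    smul_wedgeTop_eq hk _ _ ?_⟩⟩
  · rw [smul_wedgeTop_eq hk _ 0, map_zero, zero_smul]
    rw [tpowToExt_e, tpowToExt_pureTensor_top, extE_single_topSet, zero_smul]
  · rw [tpowToExt_w, tpowToExt_pureTensor_top, extDiag_single_topSet, chi,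
      eps_dotProduct, eps_dotProduct]
  · rw [tpowToExt_w', tpowToExt_pureTensor_top, extDiag_single_topSet, chi',
      eps_dotProduct, eps_dotProduct, mul_comm]

/-- The coordinate at `v₁ ∧ ⋯ ∧ vₖ` vanishes on the image of every `fᵢ`. -/
lemma tpowToExt_f_topSet {k : ℕ} (i : Fin (n - 1)) (z : TPow n p k) :
    tpowToExt n p k (U.of p.r p.s (.f i) • z) (topSet n k) = 0 := by
  rw [tpowToExt_f, extF_apply, if_neg fun h => h.2 (topSet_closed h.1)]

/-- A vector of the wedge module that is a sum of vectors in the images of the `fᵢ` is not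
the highest weight vector. -/
lemma sum_f_smul_ne_wedgeTop {k : ℕ} (hk : k ≤ n) {ι : Type*} (t : Finset ι)
    (i : ι → Fin (n - 1)) (x : ι → Wedge n p k) :
    ∑ j ∈ t, U.of p.r p.s (.f (i j)) • x j ≠ wedgeTop p hk := by
  choose z hz using fun j => (symSubmodule n p k).mkQ_surjective (x j)
  intro h
  simp only [← hz, ← map_smul, ← map_sum] at h
  rw [wedgeTop, ← sub_eq_zero, ← map_sub, ← LinearMap.mem_ker, Submodule.ker_mkQ,
    mem_symSubmodule] at h
  -- At the coordinate of the initial subset the sum contributes `0` and the top vector contributes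
  -- `1`.
  have h1 := congrFun ((map_sub _ _ _).symm.trans h) (topSet n k)
  rw [map_sum, Pi.sub_apply, Finset.sum_apply,
    Finset.sum_eq_zero fun j _ => tpowToExt_f_topSet _ _, tpowToExt_pureTensor_top] at h1
  simp at h1

end simplicity

/-! ### Verma modules -/

/-- If a sum of simultaneous eigenvectors lies in a submodule, then so does every summand whose
eigenvalues differ from those of all the others. -/
lemma eigenvector_mem {R M ι κ : Type*} [Ring R] [Algebra ℂ R] [AddCommGroup M] [Module R M]
    [Module ℂ M] [IsScalarTower ℂ R M] (N : Submodule R M) (u : ι → R) {x : M} (a : ι → ℂ)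
    (hx : ∀ i, u i • x = a i • x) (t : Finset κ) (y : κ → M) (b : κ → ι → ℂ)
    (hy : ∀ j ∈ t, ∀ i, u i • y j = b j i • y j) (hab : ∀ j ∈ t, b j ≠ a)
    (h : x + ∑ j ∈ t, y j ∈ N) : x ∈ N := by
  classical
  have hN (c : ℂ) (z : M) (hz : z ∈ N) : c • z ∈ N := by
    rw [← algebraMap_smul R c z]
    exact N.smul_mem _ hz
  have hcomm (i : ι) (c : ℂ) (z : M) : u i • c • z = c • u i • z := by
    rw [← algebraMap_smul R c z, ← algebraMap_smul R c (u i • z), smul_smul, smul_smul,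
      Algebra.commutes]
  induction t using Finset.induction_on generalizing x y with
  | empty => simpa using h
  | insert j t hj ih =>
    obtain ⟨i, hi⟩ := Function.ne_iff.1 (hab j (Finset.mem_insert_self j t))
    -- Applying `u i - b j i` kills `y j` and only rescales the other vectors; the factor on `x` is
    -- nonzero by the choice of `i`.
    have h1 : (a i - b j i) • x + ∑ l ∈ t, (b l i - b j i) • y l ∈ N := by
      have h2 := N.sub_mem (N.smul_mem (u i) h) (hN (b j i) _ h)
      convert h2 using 1
      have h3 : ∑ l ∈ t, u i • y l = ∑ l ∈ t, b l i • y l :=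
        Finset.sum_congr rfl fun l hl => hy l (Finset.mem_insert_of_mem hl) i
      rw [Finset.sum_insert hj, smul_add, smul_add, hx, hy j (Finset.mem_insert_self j t),
        Finset.smul_sum, h3, smul_add, smul_add, Finset.smul_sum]
      simp only [sub_smul, Finset.sum_sub_distrib]
      abel
    have h4 := ih (x := (a i - b j i) • x) (fun i' => by rw [hcomm, hx, smul_comm])
      (fun l => (b l i - b j i) • y l)
      (fun l hl i' => by rw [hcomm, hy l (Finset.mem_insert_of_mem hl), smul_comm])
      (fun l hl => hab l (Finset.mem_insert_of_mem hl)) h1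
    have h5 := hN (a i - b j i)⁻¹ _ h4
    rwa [smul_smul, inv_mul_cancel₀ (sub_ne_zero.2 hi.symm), one_smul] at h5

section verma

variable {n : ℕ} {p : Params} {μ : Fin n → ℤ}

lemma chi_add (μ ν : Fin n → ℤ) (i : Fin (n - 1)) :
    chi p.r p.s (μ + ν) i = chi p.r p.s μ i * chi p.r p.s ν i := by
  simp only [chi, dotProduct_add, zpow_add₀ p.r_ne_zero, zpow_add₀ p.s_ne_zero]
  ring

lemma chi'_add (μ ν : Fin n → ℤ) (i : Fin (n - 1)) :
    chi' p.r p.s (μ + ν) i = chi' p.r p.s μ i * chi' p.r p.s ν i := by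
  simp only [chi', dotProduct_add, zpow_add₀ p.r_ne_zero, zpow_add₀ p.s_ne_zero]
  ring

lemma chi_ne_zero (μ : Fin n → ℤ) (i : Fin (n - 1)) : chi p.r p.s μ i ≠ 0 :=
  mul_ne_zero (zpow_ne_zero _ p.r_ne_zero) (zpow_ne_zero _ p.s_ne_zero)

lemma chi'_ne_zero (μ : Fin n → ℤ) (i : Fin (n - 1)) : chi' p.r p.s μ i ≠ 0 :=
  mul_ne_zero (zpow_ne_zero _ p.r_ne_zero) (zpow_ne_zero _ p.s_ne_zero)

/-! ### Weights and characters of words in the `fⱼ` -/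

/-- The weight of a product of the `fⱼ`. -/
def wordWeight (l : List (Fin (n - 1))) : Fin n → ℤ := (l.map fun j => -simpleRoot j).sum

lemma sum_wordWeight (l : List (Fin (n - 1))) : ∑ a, wordWeight l a = 0 := by
  induction l with
  | nil => simp [wordWeight]
  | cons j l ih =>
    simp only [wordWeight, List.map_cons, List.sum_cons, Pi.add_apply, Finset.sum_add_distrib] at *
    rw [ih]
    simp [simpleRoot, eps]

/-- Pairing with `(0, 1, …, n - 1)` gives `1` on each `-αⱼ`, so it counts letters. With the
vanishing coordinate sum, it shows that a constant word weight comes only from the empty word. -/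
lemma sum_mul_wordWeight (l : List (Fin (n - 1))) :
    ∑ a, (a.val : ℤ) * wordWeight l a = l.length := by
  induction l with
  | nil => simp [wordWeight]
  | cons j l ih =>
    simp only [wordWeight, List.map_cons, List.sum_cons, Pi.add_apply, Finset.sum_add_distrib,
      mul_add] at *
    rw [ih]
    simp [simpleRoot, eps, Pi.single_apply, mul_sub, lo, hi]
    ring

/-- If `r / s` is not a root of unity, then a nontrivial product of the `fⱼ` has a nontrivial
character. -/
lemma wordWeight_character (hq : ∀ m : ℕ, 0 < m → (p.r / p.s) ^ m ≠ 1) {l : List (Fin (n - 1))}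
    (h : ∀ i, chi p.r p.s (wordWeight l) i = 1) (h' : ∀ i, chi' p.r p.s (wordWeight l) i = 1) :
    l = [] := by
  have hr := p.r_ne_zero
  have hs := p.s_ne_zero
  have hz (m : ℤ) (hm : (p.r / p.s) ^ m = 1) : m = 0 := by
    by_contra h0
    refine hq m.natAbs (Int.natAbs_pos.2 h0) ?_
    rcases Int.natAbs_eq m with h1 | h1
    · rwa [h1, zpow_natCast] at hm
    · rwa [h1, zpow_neg, inv_eq_one, zpow_natCast] at hm
  -- The quotient of `chi` by `chi'` is `r/s` to the power of the difference of adjacent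
  -- coordinates, so these coordinates agree.
  have h1 (i : Fin (n - 1)) : wordWeight l (lo i) = wordWeight l (hi i) := by
    have h2 := h i
    have h3 := h' i
    simp only [chi, chi', eps_dotProduct] at h2 h3
    refine sub_eq_zero.1 (hz _ ?_)
    rw [zpow_sub₀ (div_ne_zero hr hs), div_zpow, div_zpow, div_div_div_eq, mul_comm (p.s ^ _), h2]
    rw [h3, div_one]
  rcases l with _ | ⟨j, l⟩
  · rfl
  have h2 (d : ℕ) (hd : d < n) : wordWeight (j :: l) ⟨d, hd⟩ = wordWeight (j :: l) (lo j) := by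
    have h3 (d : ℕ) (hd : d < n) : wordWeight (j :: l) ⟨d, hd⟩
        = wordWeight (j :: l) ⟨0, by omega⟩ := by
      induction d with
      | zero => rfl
      | succ d ih => exact (h1 ⟨d, by omega⟩).symm.trans (ih (by omega))
    rw [h3 d hd]
    exact (h3 _ (lo j).isLt).symm
  have h4 := sum_wordWeight (j :: l)
  rw [Finset.sum_congr rfl fun a _ => h2 a.val a.isLt] at h4
  -- All coordinates are equal and their sum is zero.
  have h5 : wordWeight (j :: l) (lo j) = 0 := by
    have := (lo j).isLt
    simpa [(show n ≠ 0 by omega)] using h4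
  have h6 := sum_mul_wordWeight (j :: l)
  rw [Finset.sum_eq_zero fun a _ => by rw [h2 a.val a.isLt, h5, mul_zero]] at h6
  simp at h6
  omega

/-! ### Spanning of the Verma module by words in the `fⱼ` -/

/-- The image of the generator of the Verma module under a product of the `fⱼ`. -/
def vermaWord (p : Params) (μ : Fin n → ℤ) : List (Fin (n - 1)) → Verma p.r p.s μ
  | [] => vermaGen p.r p.s μ
  | j :: l => U.of p.r p.s (.f j) • vermaWord p μ l

lemma mkQ_vermaIdeal (u : U n p.r p.s) : (vermaIdeal p.r p.s μ).mkQ u = u • vermaGen p.r p.s μ := by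
  rw [vermaGen, ← map_smul, smul_eq_mul, mul_one]

lemma smul_vermaGen_eq_zero {u : U n p.r p.s} (hu : u ∈ vermaIdeal p.r p.s μ) :
    u • vermaGen p.r p.s μ = 0 := by
  rwa [← mkQ_vermaIdeal, ← LinearMap.mem_ker, Submodule.ker_mkQ]

lemma e_smul_vermaGen (i : Fin (n - 1)) : U.of p.r p.s (.e i) • vermaGen p.r p.s μ = 0 :=
  smul_vermaGen_eq_zero (Submodule.subset_span (Set.mem_iUnion.2 ⟨i, by simp⟩))

lemma w_smul_vermaGen (i : Fin (n - 1)) : U.of p.r p.s (.w i) • vermaGen p.r p.s μ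
    = chi p.r p.s μ i • vermaGen p.r p.s μ := by
  rw [← sub_eq_zero, ← algebraMap_smul (U n p.r p.s) (chi p.r p.s μ i), ← sub_smul]
  exact smul_vermaGen_eq_zero (Submodule.subset_span (Set.mem_iUnion.2 ⟨i, by simp⟩))

lemma w'_smul_vermaGen (i : Fin (n - 1)) : U.of p.r p.s (.w' i) • vermaGen p.r p.s μ
    = chi' p.r p.s μ i • vermaGen p.r p.s μ := by
  rw [← sub_eq_zero, ← algebraMap_smul (U n p.r p.s) (chi' p.r p.s μ i), ← sub_smul]
  exact smul_vermaGen_eq_zero (Submodule.subset_span (Set.mem_iUnion.2 ⟨i, by simp⟩))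

lemma smul_smul_verma (u : U n p.r p.s) (c : ℂ) (x : Verma p.r p.s μ) :
    u • c • x = c • u • x := by
  rw [← algebraMap_smul (U n p.r p.s) c x, ← algebraMap_smul (U n p.r p.s) c (u • x), smul_smul,
    smul_smul, Algebra.commutes]

lemma w_smul_vermaWord (i : Fin (n - 1)) (l : List (Fin (n - 1))) :
    U.of p.r p.s (.w i) • vermaWord p μ l
      = (chi p.r p.s (wordWeight l) i * chi p.r p.s μ i) • vermaWord p μ l := by
  induction l with
  | nil => simp [vermaWord, w_smul_vermaGen, wordWeight, chi]
  | cons j l ih =>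
    rw [vermaWord, smul_smul, U.w_f, smul_assoc, mul_smul, ih, smul_smul_verma, smul_smul,
      ← mul_assoc, ← chi_add]
    rfl

lemma w'_smul_vermaWord (i : Fin (n - 1)) (l : List (Fin (n - 1))) :
    U.of p.r p.s (.w' i) • vermaWord p μ l
      = (chi' p.r p.s (wordWeight l) i * chi' p.r p.s μ i) • vermaWord p μ l := by
  induction l with
  | nil => simp [vermaWord, w'_smul_vermaGen, wordWeight, chi']
  | cons j l ih =>
    rw [vermaWord, smul_smul, U.w'_f, smul_assoc, mul_smul, ih, smul_smul_verma, smul_smul,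
      ← mul_assoc, ← chi'_add]
    rfl

lemma inv_smul_of_smul {u u' : U n p.r p.s} (h : u' * u = 1) {c : ℂ} (hc : c ≠ 0)
    {x : Verma p.r p.s μ} (hx : u • x = c • x) : u' • x = c⁻¹ • x := by
  rw [eq_inv_smul_iff₀ hc, ← smul_smul_verma, ← hx, smul_smul, h, one_smul]

/-- Stability of the span of the words under an element may be checked on the words. -/
lemma smul_mem_span_vermaWord {u : U n p.r p.s}
    (h : ∀ l, u • vermaWord p μ l ∈ Submodule.span ℂ (Set.range (vermaWord p μ)))
    {x : Verma p.r p.s μ} (hx : x ∈ Submodule.span ℂ (Set.range (vermaWord p μ))) :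
    u • x ∈ Submodule.span ℂ (Set.range (vermaWord p μ)) := by
  induction hx using Submodule.span_induction with
  | mem x hx => obtain ⟨l, rfl⟩ := hx; exact h l
  | zero => rw [smul_zero]; exact Submodule.zero_mem _
  | add x y _ _ hx hy => rw [smul_add]; exact add_mem hx hy
  | smul c x _ hx => rw [smul_smul_verma]; exact Submodule.smul_mem _ _ hx

/-- Moving `eᵢ` to the right past each `fⱼ` leaves commutators in the `ω`, `ω'`, which scale words;
at the end `eᵢ` kills the generator. -/
lemma e_smul_vermaWord_mem (i : Fin (n - 1)) (l : List (Fin (n - 1))) :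
    U.of p.r p.s (.e i) • vermaWord p μ l ∈ Submodule.span ℂ (Set.range (vermaWord p μ)) := by
  induction l with
  | nil => rw [vermaWord, e_smul_vermaGen]; exact Submodule.zero_mem _
  | cons j l ih =>
    have h1 := smul_mem_span_vermaWord (p := p) (μ := μ) (u := U.of p.r p.s (.f j))
      (fun l => Submodule.subset_span ⟨j :: l, rfl⟩) ih
    have h2 (l : List (Fin (n - 1))) (c : ℂ) :
        c • vermaWord p μ l ∈ Submodule.span ℂ (Set.range (vermaWord p μ)) :=
      Submodule.smul_mem _ _ (Submodule.subset_span ⟨l, rfl⟩)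
    rw [vermaWord, smul_smul]
    by_cases h : i = j
    · subst h
      rw [eq_add_of_sub_eq (U.e_f_same i), add_smul, mul_smul, smul_assoc, sub_smul,
        w_smul_vermaWord, w'_smul_vermaWord]
      exact add_mem (Submodule.smul_mem _ _ (sub_mem (h2 _ _) (h2 _ _))) h1
    · rwa [U.e_f_ne h, mul_smul]

/-- The span contains the generator and is stable under all of `U`. Words may be linearly dependent:
only spanning is needed later. -/
lemma span_vermaWord : Submodule.span ℂ (Set.range (vermaWord p μ)) = ⊤ := by
  have key (u : U n p.r p.s) : ∀ x ∈ Submodule.span ℂ (Set.range (vermaWord p μ)),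
      u • x ∈ Submodule.span ℂ (Set.range (vermaWord p μ)) := by
    have h2 (l : List (Fin (n - 1))) (c : ℂ) :
        c • vermaWord p μ l ∈ Submodule.span ℂ (Set.range (vermaWord p μ)) :=
      Submodule.smul_mem _ _ (Submodule.subset_span ⟨l, rfl⟩)
    refine U.induction (P := fun u => ∀ x ∈ Submodule.span ℂ (Set.range (vermaWord p μ)),
      u • x ∈ Submodule.span ℂ (Set.range (vermaWord p μ))) (fun c x hx => ?_) (fun g x hx => ?_)
      (fun a b ha hb x hx => ?_) (fun a b ha hb x hx => ?_) u
    · rw [algebraMap_smul]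
      exact Submodule.smul_mem _ _ hx
    · refine smul_mem_span_vermaWord (fun l => ?_) hx
      cases g with
      | e i => exact e_smul_vermaWord_mem i l
      | f j => exact Submodule.subset_span ⟨j :: l, rfl⟩
      | w i => rw [w_smul_vermaWord]; exact h2 _ _
      | w' i => rw [w'_smul_vermaWord]; exact h2 _ _
      | wInv i =>
        rw [inv_smul_of_smul (U.inv_mul_w i) (mul_ne_zero (chi_ne_zero _ _) (chi_ne_zero _ _))
          (w_smul_vermaWord i l)]
        exact h2 _ _
      | wInv' i =>
        rw [inv_smul_of_smul (U.inv_mul_w' i) (mul_ne_zero (chi'_ne_zero _ _) (chi'_ne_zero _ _))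
          (w'_smul_vermaWord i l)]
        exact h2 _ _
    · rw [mul_smul]
      exact ha _ (hb x hx)
    · rw [add_smul]
      exact add_mem (ha x hx) (hb x hx)
  refine eq_top_iff.2 fun x _ => ?_
  obtain ⟨u, rfl⟩ := (vermaIdeal p.r p.s μ).mkQ_surjective x
  rw [mkQ_vermaIdeal]
  exact key u _ (Submodule.subset_span ⟨[], rfl⟩)

lemma eq_top_of_vermaGen_mem {N : Submodule (U n p.r p.s) (Verma p.r p.s μ)}
    (h : vermaGen p.r p.s μ ∈ N) : N = ⊤ := by
  refine eq_top_iff.2 fun x _ => ?_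
  obtain ⟨u, rfl⟩ := (vermaIdeal p.r p.s μ).mkQ_surjective x
  rw [mkQ_vermaIdeal]
  exact N.smul_mem u h

/-- If `r / s` is not a root of unity, then the vectors of a proper submodule of the Verma module
are sums of vectors in the images of the `fⱼ`. -/
lemma exists_sum_f_smul (hq : ∀ m : ℕ, 0 < m → (p.r / p.s) ^ m ≠ 1)
    {N : Submodule (U n p.r p.s) (Verma p.r p.s μ)} (hN : N ≠ ⊤) {x : Verma p.r p.s μ}
    (hx : x ∈ N) : ∃ (ι : Type) (t : Finset ι) (j : ι → Fin (n - 1)) (y : ι → Verma p.r p.s μ),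
      ∑ a ∈ t, U.of p.r p.s (.f (j a)) • y a = x := by
  have hspan : x ∈ Submodule.span ℂ (Set.range (vermaWord p μ)) := span_vermaWord ▸ trivial
  obtain ⟨c, rfl⟩ := Finsupp.mem_span_range_iff_exists_finsupp.1 hspan
  -- The empty word is separated from the others by the joint eigenvalues of the `ωᵢ` and `ω'ᵢ`,
  -- indexed together by a sum type.
  have h0 : c [] • vermaGen p.r p.s μ ∈ N := by
    have heig (l : List (Fin (n - 1))) (i : Fin (n - 1) ⊕ Fin (n - 1)) :
        (Sum.elim (fun i => U.of p.r p.s (.w i)) (fun i => U.of p.r p.s (.w' i)) i) •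
          c l • vermaWord p μ l =
        (Sum.elim (fun i => chi p.r p.s (wordWeight l) i * chi p.r p.s μ i)
          (fun i => chi' p.r p.s (wordWeight l) i * chi' p.r p.s μ i) i) •
          c l • vermaWord p μ l := by
      rcases i with i | i
      · rw [Sum.elim_inl, Sum.elim_inl, smul_smul_verma, w_smul_vermaWord, smul_comm]
      · rw [Sum.elim_inr, Sum.elim_inr, smul_smul_verma, w'_smul_vermaWord, smul_comm]
    refine eigenvector_mem N _ _ (heig []) (c.support.erase []) (fun l => c l • vermaWord p μ l) _
      (fun l _ => heig l) (fun l hl he => ?_) ?_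
    · refine Finset.ne_of_mem_erase hl (wordWeight_character hq (fun i => ?_) fun i => ?_)
      · rw [mul_right_cancel₀ (chi_ne_zero μ i) (congrFun he (Sum.inl i))]
        simp [wordWeight, chi]
      · rw [mul_right_cancel₀ (chi'_ne_zero μ i) (congrFun he (Sum.inr i))]
        simp [wordWeight, chi']
    · convert hx using 1
      by_cases h : [] ∈ c.support
      · exact Finset.add_sum_erase _ (fun l => c l • vermaWord p μ l) h
      · rw [Finset.erase_eq_of_notMem h, Finsupp.notMem_support_iff.1 h, zero_smul, zero_add]
        rfl
  have hc : c [] = 0 := by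
    by_contra hc
    refine hN (eq_top_of_vermaGen_mem ?_)
    have h1 := N.smul_mem (algebraMap ℂ _ (c [])⁻¹) h0
    rwa [algebraMap_smul, smul_smul, inv_mul_cancel₀ hc, one_smul] at h1
  -- With the empty word gone, every remaining word starts with some `fⱼ`.
  have hcons (l : c.support) : ∃ j l', l.1 = j :: l' :=
    List.exists_cons_of_ne_nil fun h => Finsupp.mem_support_iff.1 l.2 (h ▸ hc)
  choose j l' hl using hcons
  refine ⟨c.support, Finset.univ, j, fun l => c l • vermaWord p μ (l' l), ?_⟩
  rw [Finsupp.sum, ← Finset.sum_coe_sort c.support]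
  refine Finset.sum_congr rfl fun l _ => ?_
  rw [smul_smul_verma]
  conv_rhs => rw [hl l]
  rw [vermaWord, hl l]

/-! ### Simple highest weight modules as quotients of the Verma module -/

/-- The homomorphism from the Verma module that a highest weight vector defines. -/
def vermaLift {M : Type} [AddCommGroup M] [Module (U n p.r p.s) M] {x : M}
    (hx : IsHighestWeightVector (r := p.r) (s := p.s) μ x) :
    Verma p.r p.s μ →ₗ[U n p.r p.s] M :=
  (vermaIdeal p.r p.s μ).liftQ (LinearMap.toSpanSingleton (U n p.r p.s) M x) (by
    refine Submodule.span_le.2 (Set.iUnion_subset fun i => ?_)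
    obtain ⟨h1, h2, h3⟩ := hx.2 i
    rintro u (rfl | rfl | rfl)
    · exact LinearMap.mem_ker.2 h1
    · exact LinearMap.mem_ker.2 (by simp [sub_smul, h2])
    · exact LinearMap.mem_ker.2 (by simp [sub_smul, h3]))

lemma vermaLift_vermaGen {M : Type} [AddCommGroup M] [Module (U n p.r p.s) M] {x : M}
    (hx : IsHighestWeightVector (r := p.r) (s := p.s) μ x) :
    vermaLift hx (vermaGen p.r p.s μ) = x :=
  (Submodule.liftQ_apply _ _ _).trans (one_smul _ x)

lemma vermaLift_surjective {M : Type} [AddCommGroup M] [Module (U n p.r p.s) M]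
    [IsSimpleModule (U n p.r p.s) M] {x : M}
    (hx : IsHighestWeightVector (r := p.r) (s := p.s) μ x) :
    Function.Surjective (vermaLift hx) := by
  refine (LinearMap.surjective_or_eq_zero (vermaLift hx)).resolve_right fun h => hx.1 ?_
  rw [← vermaLift_vermaGen hx, h, LinearMap.zero_apply]

lemma isCoatom_ker_vermaLift {M : Type} [AddCommGroup M] [Module (U n p.r p.s) M]
    [IsSimpleModule (U n p.r p.s) M] {x : M}
    (hx : IsHighestWeightVector (r := p.r) (s := p.s) μ x) :
    IsCoatom (LinearMap.ker (vermaLift hx)) :=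
  LinearMap.isCoatom_ker_of_surjective (vermaLift_surjective hx)

/-- A simple highest weight module is the quotient of the Verma module by the kernel of
`vermaLift`. -/
def simpleEquiv {M : Type} [AddCommGroup M] [Module (U n p.r p.s) M]
    [IsSimpleModule (U n p.r p.s) M] {x : M}
    (hx : IsHighestWeightVector (r := p.r) (s := p.s) μ x) :
    M ≃ₗ[U n p.r p.s] (Verma p.r p.s μ ⧸ LinearMap.ker (vermaLift hx)) :=
  ((vermaLift hx).quotKerEquivOfSurjective (vermaLift_surjective hx)).symm

lemma simpleEquiv_apply {M : Type} [AddCommGroup M] [Module (U n p.r p.s) M]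
    [IsSimpleModule (U n p.r p.s) M] {x : M}
    (hx : IsHighestWeightVector (r := p.r) (s := p.s) μ x) :
    simpleEquiv hx x = (LinearMap.ker (vermaLift hx)).mkQ (vermaGen p.r p.s μ) := by
  rw [simpleEquiv, LinearEquiv.symm_apply_eq, Submodule.mkQ_apply,
    LinearMap.quotKerEquivOfSurjective_apply_mk, vermaLift_vermaGen]

end verma

/-- The kernel is proper, hence one of the submodules summed. Conversely, the image of a proper
submodule in the simple module `W_k` is zero or everything; the latter would write the top vector as
a sum of vectors in the images of the `fⱼ`, against `sum_f_smul_ne_wedgeTop`. -/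
lemma vermaRad_eq_ker {n k : ℕ} {p : Params} (hk : k ≤ n)
    (hq : ∀ m : ℕ, 0 < m → (p.r / p.s) ^ m ≠ 1) :
    vermaRad p.r p.s (fundWeight n k) =
      LinearMap.ker (vermaLift (isHighestWeightVector_wedgeTop (p := p) hk)) := by
  have := isSimpleModule_wedge (p := p) hk
  refine le_antisymm (sSup_le fun N hN => ?_) (le_sSup (isCoatom_ker_vermaLift _).1)
  rw [LinearMap.le_ker_iff_map]
  refine (eq_bot_or_eq_top _).resolve_right fun h => ?_
  have h1 : (wedgeTop p hk : Wedge n p k) ∈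
      N.map (vermaLift (isHighestWeightVector_wedgeTop (p := p) hk)) := h ▸ Submodule.mem_top
  obtain ⟨x, hx, hx'⟩ := h1
  obtain ⟨ι, t, j, y, rfl⟩ := exists_sum_f_smul hq hN hx
  simp only [map_sum, map_smul] at hx'
  exact sum_f_smul_ne_wedgeTop hk t j _ hx'

end RSWedge

end

theorem mainTheorem3 (n k : ℕ) (hk : 1 ≤ k) (hkn : k < n) (p : Params) :
    -- the image of `v₁ ⊗ ⋯ ⊗ vₖ` is a highest weight vector of weight `ε₁ + ⋯ + εₖ`
    IsHighestWeightVector (r := p.r) (s := p.s) (fundWeight n k)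
        (wedgeTop p hkn.le : Wedge n p k) ∧
    -- the wedge module is simple
    IsSimpleModule (U n p.r p.s) (Wedge n p k) ∧
    -- it is a simple quotient of the Verma module, with matching highest weight vectors
    (∃ N : Submodule (U n p.r p.s) (Verma p.r p.s (fundWeight n k)), IsCoatom N ∧
      ∃ φ : Wedge n p k ≃ₗ[U n p.r p.s] (Verma p.r p.s (fundWeight n k) ⧸ N),
        φ (wedgeTop p hkn.le) = N.mkQ (vermaGen p.r p.s (fundWeight n k))) ∧
    -- if `r / s` is not a root of unity, the Verma module has a largest proper submodule, and the
    -- wedge module is the quotient by it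
    ((∀ m : ℕ, 0 < m → (p.r / p.s) ^ m ≠ 1) →
      IsCoatom (vermaRad p.r p.s (fundWeight n k)) ∧
      ∃ φ : Wedge n p k ≃ₗ[U n p.r p.s] SimpleHW p.r p.s (fundWeight n k),
        φ (wedgeTop p hkn.le)
          = (vermaRad p.r p.s (fundWeight n k)).mkQ (vermaGen p.r p.s (fundWeight n k))) := by
  have hw := isHighestWeightVector_wedgeTop (p := p) hkn.le
  have := isSimpleModule_wedge (p := p) hkn.le
  refine ⟨hw, this, ⟨_, isCoatom_ker_vermaLift hw, simpleEquiv hw, simpleEquiv_apply hw⟩,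
    fun hq => ?_⟩
  have h := vermaRad_eq_ker hkn.le hq
  -- Once the radical is identified with the kernel, the last claim is the quotient description
  -- already used for the third.
  unfold SimpleHW
  rw [h]
  exact ⟨isCoatom_ker_vermaLift hw, simpleEquiv hw, simpleEquiv_apply hw⟩
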